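/- A finite group is supersolvable if all its chief factors are cyclic; let $\mathbf{Su}$ be the class of finite supersolvable groups. For a group $F$, the pro-$\mathbf{Su}$ topology on $F$ is the coarsest topology that makes every homomorphism from $F$ to a member of $\mathbf{Su}$ (with the discrete topology) continuous; a subgroup of $F$ is $\mathbf{Su}$-dense if it is dense in this topology. **Theorem.** Let $F$ be a free group of arbitrary (finite or infinite) rank. Given a finitely generated subgroup $H$ of $F$, it is decidable whether or not $H$ is $\mathbf{Su}$-dense. Precisely: there is a single algorithm which, for every free group $F$ with basis $X$ and every finite list $W$ of words over $X\cup X^{-1}$ generating a subgroup $H$ of $F$, takes as input the rank of $F$ (the natural number $|X|$ if $X$ is finite, the symbol $\infty$ if $X$ is infinite) and the list $W$, in which the finitely many elements of $X$ that occur are named by distinct natural numbers, and decides whether or not $H$ is $\mathbf{Su}$-dense. -/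

import Mathlib

/-- For subgroups `K` and `L` of `G`, the section `L / K` is a chief factor of `G`: both are normal
in `G`, `K < L`, and no normal subgroup of `G` lies strictly between them (so that `L / K` is a
minimal normal subgroup of `G / K`). -/
structure IsChiefFactor {G : Type*} [Group G] (K L : Subgroup G) : Prop where
  normal_bot : K.Normal
  normal_top : L.Normal
  lt : K < L
  eq_or_eq : ∀ N : Subgroup G, N.Normal → K ≤ N → N ≤ L → N = K ∨ N = L

/-- The class of finite supersolvable groups: the finite groups all of whose chief factors are
cyclic. -/
def FiniteSupersolvable (G : Type*) [Group G] : Prop :=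
  Finite G ∧ ∀ (K L : Subgroup G) [K.Normal], IsChiefFactor K L → IsCyclic (L ⧸ K.subgroupOf L)

/-- The pro-`V` topology on a group `G`, for a class `V` of (finite) groups: the coarsest topology
that makes every homomorphism from `G` to a discrete member of `V` continuous. Every finite group
is isomorphic to one in `Type`, so nothing is lost by taking the members of `V` there. -/
abbrev proTopology (V : (Q : Type) → [Group Q] → Prop) (G : Type*) [Group G] : TopologicalSpace G :=
  ⨅ (Q : Type) (_ : Group Q) (_ : V Q) (φ : G →* Q), TopologicalSpace.induced φ ⊥

/-- The subgroup `H` of `G` is dense in the pro-`V` topology. -/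
def IsProDense (V : (Q : Type) → [Group Q] → Prop) {G : Type*} [Group G] (H : Subgroup G) : Prop :=
  @Dense G (proTopology V G) (H : Set G)

/-- A word over the alphabet `X ∪ X⁻¹`: the letter `(x, true)` stands for `x` and `(x, false)` for
`x⁻¹`. Words need not be reduced. -/
abbrev GroupWord (X : Type*) : Type _ := List (X × Bool)

/-- The element of the group `F` that a word represents, when the letter `x` stands for `b x`. -/
def GroupWord.value {X F : Type*} [Group F] (b : X → F) (w : GroupWord X) : F :=
  (w.map fun l => if l.2 then b l.1 else (b l.1)⁻¹).prod

/-- The subgroup generated by the elements that the words of a finite list represent. -/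
def subgroupOfWords {X F : Type*} [Group F] (b : X → F) (W : List (GroupWord X)) : Subgroup F :=
  Subgroup.closure {g | ∃ w ∈ W, g = w.value b}

/-- The elements of `X` that occur in a list of words, with either exponent. -/
def lettersOf {X : Type*} (W : List (GroupWord X)) : Set X :=
  {x | ∃ w ∈ W, ∃ e : Bool, (x, e) ∈ w}

/-- The list of words that is obtained by writing the name `ν x` for each letter `x`. -/
def renameWords {X Y : Type*} (ν : X → Y) (W : List (GroupWord X)) : List (GroupWord Y) :=
  W.map fun w => w.map fun l => (ν l.1, l.2)

open scoped Classical in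
/-- The rank of a free group on `X`, as a finite datum: `some d` if `X` has exactly `d` elements,
and `none` if `X` is infinite. -/
noncomputable def rankDatum (X : Type*) : Option ℕ :=
  if Finite X then some (Nat.card X) else none

/-! A finite supersolvable group has a normal series with factors of prime order. If `H` is not
dense in `F`, then `HN ≠ F` for some term `N` of such a series in `F`. At the first step `K < L`
with `HL = F ≠ HK`, the subgroup `HK` meets `L` in `K`, so its cosets correspond to `L/K ≅ ℤ/p`. The
group `F` acts on them by affine maps, and `H` fixes `0`. Since the affine group modulo `p` is
supersolvable, `H` fails to be dense exactly when some homomorphism to such a group makes `H`, but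
not `F`, fix `0` (`not_isProDense_iff_exists_affine_hom`).

A homomorphism on a free group is a free choice of images of the basis. If some basis element does
not occur in the given words, `H` is not dense. Otherwise non-density says that a system of
polynomial equations over `ℤ`, computed from the words, is solvable over `𝔽_p` for some prime `p`.

Solvability modulo some prime is semi-decidable by search. So is its negation: if the ideal `I` of
the system contains no nonzero integer, `ℤ[X]/I` maps to a field of characteristic zero, hence by
Zariski's lemma the system is solvable in a number field, and Schur's theorem on prime divisors of
polynomial values gives a prime modulo which that solution reduces into `𝔽_p`. An unsolvable system
therefore has a nonzero integer `N` in `I`, witnessed by a finite derivation. Conversely, given `N`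
in `I`, solutions exist only modulo divisors of `N`, so checking the primes up to `N` completes the
refutation (`PolySystem.not_solvableModPrime_iff`). -/

/-! ### Affine groups and their supersolvability -/

/-- The group of affine permutations `y ↦ a * y + b` of a commutative ring. -/
@[ext] structure AffineGroup (R : Type*) [CommRing R] where
  scale : Rˣ
  shift : R

namespace AffineGroup

variable {R : Type*} [CommRing R]

instance : Mul (AffineGroup R) := ⟨fun f g => ⟨f.scale * g.scale, f.scale * g.shift + f.shift⟩⟩
instance : One (AffineGroup R) := ⟨⟨1, 0⟩⟩
instance : Inv (AffineGroup R) := ⟨fun f => ⟨f.scale⁻¹, -((f.scale⁻¹ : Rˣ) * f.shift)⟩⟩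

@[simp] theorem mul_scale (f g : AffineGroup R) : (f * g).scale = f.scale * g.scale := rfl
@[simp] theorem mul_shift (f g : AffineGroup R) :
    (f * g).shift = f.scale * g.shift + f.shift := rfl
@[simp] theorem one_scale : (1 : AffineGroup R).scale = 1 := rfl
@[simp] theorem one_shift : (1 : AffineGroup R).shift = 0 := rfl
@[simp] theorem inv_scale (f : AffineGroup R) : f⁻¹.scale = f.scale⁻¹ := rfl
@[simp] theorem inv_shift (f : AffineGroup R) :
    f⁻¹.shift = -((f.scale⁻¹ : Rˣ) * f.shift) := rfl

instance : Group (AffineGroup R) :=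
  Group.ofLeftAxioms
    (fun f g h => by ext <;> simp <;> ring)
    (fun f => by ext <;> simp)
    (fun f => by ext <;> simp)

/-- The linear part of an affine permutation. -/
def scaleHom : AffineGroup R →* Rˣ where
  toFun := scale
  map_one' := rfl
  map_mul' _ _ := rfl

/-- The stabilizer of `0`. -/
def stabilizerZero (R : Type*) [CommRing R] : Subgroup (AffineGroup R) where
  carrier := {f | f.shift = 0}
  mul_mem' {f g} hf hg := by simp_all
  one_mem' := rfl
  inv_mem' {f} hf := by simp_all

instance [Finite R] : Finite (AffineGroup R) :=
  Finite.of_injective (fun f : AffineGroup R => (f.scale, f.shift)) fun f g h => by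
    ext <;> simp_all

theorem card_ker_scaleHom : Nat.card (scaleHom (R := R)).ker = Nat.card R := by
  refine Nat.card_congr ⟨fun f => f.1.shift, fun r => ⟨⟨1, r⟩, rfl⟩, ?_, fun r => rfl⟩
  rintro ⟨f, hf⟩
  have hf' : f.scale = 1 := hf
  ext <;> simp [hf']

end AffineGroup

/-- If `L` meets the kernel inside `K`, then `L/K` is a quotient of the cyclic group `f(L)`.
Otherwise `L` contains the kernel, which has prime order, and minimality gives `L = K · ker f`, so
`L/K` is a quotient of the kernel. -/
theorem IsChiefFactor.isCyclic_of_ker_prime {G C : Type*} [Group G] [Group C] [IsCyclic C]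
    (f : G →* C) (hf : (Nat.card f.ker).Prime) {K L : Subgroup G} [K.Normal]
    (h : IsChiefFactor K L) : IsCyclic (L ⧸ K.subgroupOf L) := by
  have := h.normal_top
  by_cases hT : f.ker ⊓ L ≤ K
  · obtain ⟨⟨c, hc⟩, hgen⟩ := IsCyclic.exists_generator (α := L.map f)
    obtain ⟨g, hg, rfl⟩ := hc
    refine ⟨⟨QuotientGroup.mk ⟨g, hg⟩, fun x => ?_⟩⟩
    induction x using QuotientGroup.induction_on with | H y => ?_
    obtain ⟨n, hn⟩ := hgen ⟨f y, y, y.2, rfl⟩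
    refine ⟨n, ?_⟩
    have hn' : f g ^ n = f y := congrArg Subtype.val hn
    change ((⟨g, hg⟩ ^ n : L) : L ⧸ K.subgroupOf L) = y
    rw [QuotientGroup.eq, Subgroup.mem_subgroupOf]
    refine hT ⟨?_, Subtype.prop _⟩
    simp [hn']
  · have : Fact (Nat.card f.ker).Prime := ⟨hf⟩
    have hTL : f.ker ≤ L := by
      rcases (L.subgroupOf f.ker).eq_bot_or_eq_top_of_prime_card with h1 | h1
      · refine absurd ?_ hT
        rw [Subgroup.subgroupOf_eq_bot] at h1
        rw [h1.symm.eq_bot]; exact bot_le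
      · exact Subgroup.subgroupOf_eq_top.mp h1
    have hN : K ⊔ f.ker = L := by
      refine (h.eq_or_eq _ inferInstance le_sup_left (sup_le h.lt.le hTL)).resolve_left fun h1 => ?_
      exact hT (inf_le_left.trans (h1 ▸ le_sup_right))
    have hcyc : IsCyclic f.ker := isCyclic_of_prime_card rfl
    obtain ⟨⟨t, ht⟩, hgen⟩ := hcyc
    refine ⟨⟨QuotientGroup.mk ⟨t, hTL ht⟩, fun x => ?_⟩⟩
    induction x using QuotientGroup.induction_on with | H y => ?_
    obtain ⟨k, hk, s, hs, hy⟩ := Subgroup.mem_sup_of_normal_right.mp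
        (hN.symm ▸ y.2 : (y : G) ∈ K ⊔ f.ker)
    obtain ⟨n, hn⟩ := hgen ⟨s, hs⟩
    refine ⟨n, ?_⟩
    have hn' : t ^ n = s := congrArg Subtype.val hn
    change ((⟨t, hTL ht⟩ ^ n : L) : L ⧸ K.subgroupOf L) = y
    rw [QuotientGroup.eq, Subgroup.mem_subgroupOf]
    have : s⁻¹ * k * s⁻¹⁻¹ ∈ K := Subgroup.Normal.conj_mem inferInstance _ hk _
    simpa [hn', ← hy, mul_assoc] using this

theorem AffineGroup.finiteSupersolvable (p : ℕ) [Fact p.Prime] :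
    FiniteSupersolvable (AffineGroup (ZMod p)) := by
  refine ⟨inferInstance, fun K L _ h => h.isCyclic_of_ker_prime scaleHom ?_⟩
  rw [card_ker_scaleHom, Nat.card_zmod]
  exact Fact.out

/-! ### Normal series with factors of prime order -/

/-- A subgroup that is the last term of a finite series of normal subgroups, starting with the whole
group, whose factors have prime order. -/
inductive PrimeChain {G : Type*} [Group G] : Subgroup G → Prop
  | top : PrimeChain ⊤
  | step {K L : Subgroup G} : PrimeChain L → K.Normal → K ≤ L → (K.relIndex L).Prime → PrimeChain K

namespace PrimeChain

variable {G : Type*} [Group G]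

theorem normal {K : Subgroup G} (h : PrimeChain K) : K.Normal := by
  cases h <;> infer_instance

/-- Intersections and preimages of a series may collapse a step; this absorbs the degenerate case.
-/
theorem step_of_dvd {K L : Subgroup G} {p : ℕ} (hp : p.Prime) (h : PrimeChain L) (hK : K.Normal)
    (hle : K ≤ L) (hdvd : K.relIndex L ∣ p) : PrimeChain K := by
  rcases (Nat.dvd_prime hp).mp hdvd with h1 | h1
  · rwa [le_antisymm hle (Subgroup.relIndex_eq_one.mp h1)]
  · exact h.step hK hle (h1 ▸ hp)

end PrimeChain

theorem Subgroup.relIndex_dvd_relIndex_of_normal {G : Type*} [Group G] (K : Subgroup G)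
    {M L : Subgroup G}
    [K.Normal] (hK : K ≤ L) (hM : M ≤ L) : K.relIndex M ∣ K.relIndex L := by
  rw [← Subgroup.relIndex_sup_left M K]
  exact ⟨_, (Subgroup.relIndex_mul_relIndex K (K ⊔ M) L le_sup_left (sup_le hK hM)).symm⟩

namespace PrimeChain

variable {G : Type*} [Group G]

theorem inf {K K' : Subgroup G} (h : PrimeChain K) (h' : PrimeChain K') : PrimeChain (K ⊓ K') := by
  have := h.normal
  induction h' with
  | top => simpa using h
  | @step K' L' _ hn hle hp ih =>
    refine step_of_dvd hp ih inferInstance (inf_le_inf_left _ hle) ?_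
    have : (K ⊓ K').relIndex (K ⊓ L') = K'.relIndex (K ⊓ L') := by
      rw [← Subgroup.inf_relIndex_right, ← Subgroup.inf_relIndex_right K']
      congr 1
      ac_nf
    rw [this]
    exact Subgroup.relIndex_dvd_relIndex_of_normal _ hle inf_le_right

theorem comap {Q : Type*} [Group Q] (f : G →* Q) {K : Subgroup Q} (h : PrimeChain K) :
    PrimeChain (K.comap f) := by
  induction h with
  | top => exact top
  | @step K L _ hn hle hp ih =>
    refine step_of_dvd hp ih inferInstance (Subgroup.comap_mono hle) ?_
    rw [Subgroup.relIndex_comap]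
    exact Subgroup.relIndex_dvd_relIndex_of_normal _ hle (Subgroup.map_comap_le _ _)

end PrimeChain

/-- For a prime `q` dividing the order, the `q`-th powers of `L/K` form a characteristic subgroup,
so they are trivial or everything. They are not everything, since by Cauchy the power map has a
kernel; so `q` kills the cyclic group `L/K`. -/
theorem IsChiefFactor.relIndex_prime {G : Type*} [Group G] [Finite G] {K L : Subgroup G}
    (h : IsChiefFactor K L) (hcyc : haveI := h.normal_bot; IsCyclic (L ⧸ K.subgroupOf L)) :
    (K.relIndex L).Prime := by
  have := h.normal_bot
  have hL := h.normal_top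
  have hne : K.relIndex L ≠ 1 := fun h1 => h.lt.not_ge (Subgroup.relIndex_eq_one.mp h1)
  obtain ⟨q, hq, hdvd⟩ := Nat.exists_prime_and_dvd hne
  have hcard : Nat.card (L ⧸ K.subgroupOf L) = K.relIndex L := rfl
  have hqf : Fact q.Prime := ⟨hq⟩
  obtain ⟨a, ha⟩ := hcyc.exists_generator
  let := hcyc.commGroup
  let pw : (L ⧸ K.subgroupOf L) →* (L ⧸ K.subgroupOf L) := powMonoidHom q
  let N : Subgroup G := (pw.range.comap (QuotientGroup.mk' (K.subgroupOf L))).map L.subtype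
  have hmem : ∀ x : L, (x : G) ∈ N ↔ (x : L ⧸ K.subgroupOf L) ∈ pw.range := by
    intro x
    constructor
    · rintro ⟨y, hy, hyx⟩
      rwa [← Subtype.ext (a1 := y) (a2 := x) hyx]
    · intro hx
      exact ⟨x, hx, rfl⟩
  have hNL : N ≤ L := by rintro _ ⟨y, -, rfl⟩; exact y.2
  have hKN : K ≤ N := fun k hk => by
    have h1 : ((⟨k, h.lt.le hk⟩ : L) : L ⧸ K.subgroupOf L) = 1 := (QuotientGroup.eq_one_iff _).mpr
        hk
    exact (hmem ⟨k, h.lt.le hk⟩).mpr (h1 ▸ one_mem _)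
  have hN : N.Normal := by
    refine ⟨fun n hn g => ?_⟩
    obtain ⟨y, ⟨z, hz⟩, rfl⟩ := hn
    induction z using QuotientGroup.induction_on with | H z => ?_
    have hz' : ((z ^ q : L) : L ⧸ K.subgroupOf L) = y := hz
    rw [QuotientGroup.eq, Subgroup.mem_subgroupOf] at hz'
    let z' : L := ⟨g * z * g⁻¹, hL.conj_mem _ z.2 g⟩
    let y' : L := ⟨g * y * g⁻¹, hL.conj_mem _ y.2 g⟩
    refine (hmem y').mpr ⟨z', ?_⟩
    change ((z' ^ q : L) : L ⧸ K.subgroupOf L) = y'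
    rw [QuotientGroup.eq, Subgroup.mem_subgroupOf]
    have h1 := h.normal_bot.conj_mem _ hz' g
    have h2 : ((z' ^ q : L) : G) = g * (z ^ q : L) * g⁻¹ := by simp [z', conj_pow]
    rw [Subgroup.coe_mul, Subgroup.coe_inv, h2]
    simpa [y', mul_assoc] using h1
  have hfin : Finite (L ⧸ K.subgroupOf L) := inferInstance
  rcases h.eq_or_eq N hN hKN hNL with h1 | h1
  · have hexp : ∀ x : L ⧸ K.subgroupOf L, x ^ q = 1 := fun x => by
      induction x using QuotientGroup.induction_on with | H x => ?_
      have : ((x ^ q : L) : G) ∈ N := (hmem _).mpr ⟨x, rfl⟩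
      rw [h1] at this
      exact (QuotientGroup.eq_one_iff (x ^ q)).mpr this
    have : K.relIndex L ∣ q := by
      rw [← hcard, ← orderOf_eq_card_of_forall_mem_zpowers ha]
      exact orderOf_dvd_of_pow_eq_one (hexp a)
    rwa [(Nat.dvd_antisymm this hdvd)]
  · exfalso
    have hsurj : Function.Surjective pw := fun x => by
      induction x using QuotientGroup.induction_on with | H x => ?_
      exact (hmem x).mp (h1.ge x.2)
    have hinj := Finite.injective_iff_surjective.mpr hsurj
    obtain ⟨x, hx⟩ := exists_prime_orderOf_dvd_card' q (hcard ▸ hdvd)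
    have : x = 1 := hinj (by simp [pw, ← hx, pow_orderOf_eq_one])
    rw [this, orderOf_one] at hx
    exact hq.one_lt.ne hx

theorem FiniteSupersolvable.primeChain_bot {G : Type*} [Group G] (h : FiniteSupersolvable G) :
    PrimeChain (⊥ : Subgroup G) := by
  obtain ⟨hfin, hc⟩ := h
  have key : ∀ L : Subgroup G, PrimeChain L → PrimeChain (⊥ : Subgroup G) := by
    intro L
    induction L using WellFoundedLT.induction with | ind L ih => ?_
    intro hL
    by_cases hbot : L = ⊥
    · rwa [← hbot]
    obtain ⟨K, ⟨hK, hlt⟩, hmax⟩ := (Set.toFinite {K : Subgroup G | K.Normal ∧ K < L}).exists_maximal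
      ⟨⊥, inferInstance, bot_lt_iff_ne_bot.mpr hbot⟩
    have hchief : IsChiefFactor K L := ⟨hK, hL.normal, hlt, fun N hN hKN hNL => by
      rcases hNL.eq_or_lt with h1 | h1
      · exact Or.inr h1
      · exact Or.inl (le_antisymm (hmax ⟨hN, h1⟩ hKN) hKN)⟩
    exact ih K hlt (hL.step hK hlt.le (hchief.relIndex_prime (hc K L hchief)))
  exact key ⊤ .top

/-! ### Density and affine actions -/

/-- A subgroup that supplements every term of a series with factors of prime order is dense. -/
theorem isProDense_of_forall_primeChain {G : Type*} [Group G] {H : Subgroup G}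
    (h : ∀ N : Subgroup G, PrimeChain N → H ⊔ N = ⊤) : IsProDense FiniteSupersolvable H := by
  let : TopologicalSpace G := proTopology FiniteSupersolvable G
  intro g
  rw [mem_closure_iff_nhds]
  intro U hU
  -- The cosets `gN` are directed because terms of series are closed under intersection. They refine
  -- the neighbourhoods of `g` because kernels of homomorphisms to supersolvable groups are such
  -- terms.
  let ℱ : Filter G := ⨅ N : {N : Subgroup G // PrimeChain N}, Filter.principal {x | g⁻¹ * x ∈ N.1}
  have hle : ℱ ≤ nhds g := by
    simp only [nhds_iInf, nhds_induced]
    refine le_iInf fun Q => le_iInf fun _ => le_iInf fun hQ => le_iInf fun φ => ?_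
    refine (iInf_le _ ⟨_, hQ.primeChain_bot.comap φ⟩).trans ?_
    let : TopologicalSpace Q := ⊥
    have : DiscreteTopology Q := ⟨rfl⟩
    rw [nhds_discrete, ← Filter.map_le_iff_le_comap, Filter.map_principal, ←
        Filter.principal_singleton,
      Filter.principal_mono]
    rintro _ ⟨x, hx, rfl⟩
    have hx' : (φ g)⁻¹ * φ x = 1 := by simpa using hx
    exact (inv_mul_eq_one.mp hx').symm
  have hne : Nonempty {N : Subgroup G // PrimeChain N} := ⟨⊤, .top⟩
  obtain ⟨N, hN⟩ := (Filter.mem_iInf_of_directed (fun N N' =>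
    ⟨⟨_, N.2.inf N'.2⟩, by
      constructor <;> refine Filter.principal_mono.mpr fun x hx => ?_
      · exact hx.1
      · exact hx.2⟩) U).mp (hle hU)
  rw [Filter.mem_principal] at hN
  have hNn := N.2.normal
  have hg : g ∈ H ⊔ N.1 := by rw [h N.1 N.2]; trivial
  obtain ⟨x, hx, n, hn, rfl⟩ := Subgroup.mem_sup_of_normal_right.mp hg
  refine ⟨x, hN ?_, hx⟩
  simpa using hn

/-- If `B` supplements `L / K`, a normal section of prime order, without containing it, the group
acts on the cosets of `B` by affine permutations. -/
theorem exists_affine_hom_of_supplement {G : Type*} [Group G] {K L B : Subgroup G} [K.Normal]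
    [L.Normal]
    (hKL : K ≤ L) {p : ℕ} [Fact p.Prime] (hp : K.relIndex L = p) (hKB : K ≤ B) (hB : B ≠ ⊤)
    (hBL : B ⊔ L = ⊤) :
    ∃ φ : G →* AffineGroup (ZMod p), (∀ g ∈ B, (φ g).shift = 0) ∧ ∃ g, (φ g).shift ≠ 0 := by
  -- `B ∩ L` lies between `K` and `L`, whose index is prime, and it is not `L` because `BL = G ≠ B`.
  have hinf : ∀ x ∈ L, x ∈ B → x ∈ K := by
    have h1 : K.relIndex (B ⊓ L) * (B ⊓ L).relIndex L = p := by
      rw [Subgroup.relIndex_mul_relIndex _ _ _ (le_inf hKB hKL) inf_le_right, hp]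
    rcases (Nat.dvd_prime Fact.out).mp (Dvd.intro _ h1) with h2 | h2
    · exact fun x hx hxB => Subgroup.relIndex_eq_one.mp h2 ⟨hxB, hx⟩
    · rw [h2] at h1
      have h3 : (B ⊓ L).relIndex L = 1 :=
        Nat.eq_of_mul_eq_mul_left (Fact.out : p.Prime).pos (h1.trans (mul_one p).symm)
      refine absurd ?_ hB
      rw [← hBL, left_eq_sup]
      exact (Subgroup.relIndex_eq_one.mp h3).trans inf_le_left
  have hcard : Nat.card (L ⧸ K.subgroupOf L) = p := hp
  have hcyc : IsCyclic (L ⧸ K.subgroupOf L) := isCyclic_of_prime_card hcard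
  let e : (L ⧸ K.subgroupOf L) ≃* Multiplicative (ZMod p) :=
    mulEquivOfCyclicCardEq (by rw [hcard]; simp)
  let q : L → ZMod p := fun x => (e x).toAdd
  have q_mul : ∀ x y, q (x * y) = q x + q y := fun x y => by simp [q]
  have q_eq_zero : ∀ x, q x = 0 ↔ (x : G) ∈ K := fun x => by
    simp only [q, toAdd_eq_zero, EmbeddingLike.map_eq_one_iff, QuotientGroup.eq_one_iff]
    rfl
  have q_surj : Function.Surjective q := fun r => by
    obtain ⟨x, hx⟩ := QuotientGroup.mk_surjective (e.symm (Multiplicative.ofAdd r))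
    exact ⟨x, by simp [q, hx]⟩
  have q_one : q 1 = 0 := (q_eq_zero 1).mpr K.one_mem
  have q_pow : ∀ x (n : ℕ), q (x ^ n) = n * q x := fun x n => by
    induction n with
    | zero => simp [q_one]
    | succ n ih => rw [pow_succ, q_mul, ih]; push_cast; ring
  have q_inv : ∀ x, q x⁻¹ = -q x := fun x => by
    rw [eq_neg_iff_add_eq_zero, ← q_mul, inv_mul_cancel, q_one]
  have hconj : ∀ (g : G) (x : L), g * x * g⁻¹ ∈ L := fun g x =>
    Subgroup.Normal.conj_mem inferInstance _ x.2 g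
  let cj : G → L → L := fun g x => ⟨g * x * g⁻¹, hconj g x⟩
  have cj_mul : ∀ g x y, cj g (x * y) = cj g x * cj g y := fun g x y => by ext; simp [cj]
  have cj_pow : ∀ g x (n : ℕ), cj g (x ^ n) = cj g x ^ n := fun g x n => by
    induction n with
    | zero => ext; simp [cj]
    | succ n ih => rw [pow_succ, cj_mul, ih, pow_succ]
  -- An additive endomorphism of `ℤ/p` is multiplication by the image of `1`; conjugation by `g` is
  -- thus the scalar `q (cj g l)`.
  obtain ⟨l, hl⟩ := q_surj 1
  have q_cj : ∀ g x, q (cj g x) = q (cj g l) * q x := fun g x => by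
    have h1 : q (l ^ (q x).val * (x⁻¹)) = 0 := by
      rw [q_mul, q_pow, q_inv, hl]; simp
    have h2 : q (cj g (l ^ (q x).val * (x⁻¹))) = 0 := by
      rw [q_eq_zero] at h1 ⊢
      exact Subgroup.Normal.conj_mem inferInstance _ h1 g
    rw [cj_mul, q_mul, cj_pow, q_pow] at h2
    have h3 : q (cj g x⁻¹) = - q (cj g x) := by
      rw [eq_neg_iff_add_eq_zero, ← q_mul, ← cj_mul, inv_mul_cancel]
      simp [cj, q_eq_zero]
    rw [h3, ZMod.natCast_zmod_val] at h2
    linear_combination -h2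
  have cj_cj : ∀ g h x, cj (g * h) x = cj g (cj h x) := fun g h x => by ext; simp [cj, mul_assoc]
  let χ : G →* ZMod p :=
    { toFun := fun g => q (cj g l)
      map_one' := by simp [cj, hl]
      map_mul' := fun g h => by rw [cj_cj, q_cj] }
  -- Since `G = LB`, every coset `gB` has a representative `s g` in `L`, unique modulo `K` by
  -- `hinf`; its coordinate `q (s g)` labels the coset.
  have hex : ∀ g : G, ∃ x : L, (x : G)⁻¹ * g ∈ B := fun g => by
    have hg : g ∈ L ⊔ B := by rw [sup_comm, hBL]; trivial
    obtain ⟨x, hx, y, hy, rfl⟩ := Subgroup.mem_sup_of_normal_left.mp hg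
    exact ⟨⟨x, hx⟩, by simpa using hy⟩
  choose s hs using hex
  have q_eq : ∀ g (x : L), (x : G)⁻¹ * g ∈ B → q (s g) = q x := fun g x hx => by
    have h1 : (x : G)⁻¹ * s g ∈ B := by
      simpa [mul_assoc] using B.mul_mem hx (B.inv_mem (hs g))
    have h2 : q (x⁻¹ * s g) = 0 := (q_eq_zero _).mpr (hinf _ (Subtype.prop _) h1)
    rw [q_mul, q_inv] at h2
    linear_combination h2
  -- The base coset `B` has label `0`, so the shift of `g` is the label of `gB`; the linear part is
  -- conjugation on `L/K`.
  refine ⟨⟨⟨fun g => ⟨χ.toHomUnits g, q (s g)⟩, ?_⟩, ?_⟩, ?_, ?_⟩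
  · ext
    · simp
    · simpa [q_one] using q_eq 1 1 (by simp)
  · intro g h
    ext
    · simp
    · simp only [AffineGroup.mul_shift, MonoidHom.coe_toHomUnits]
      -- With `a = s g` and `b = s h`, the representative `g b g⁻¹ a` of `ghB` is correct because
      -- `(g b g⁻¹ a)⁻¹ g h = (a⁻¹ g)(b⁻¹ h)`.
      rw [q_eq (g * h) (cj g (s h) * s g), q_mul, q_cj]
      · rfl
      · simpa [cj, mul_assoc] using B.mul_mem (hs g) (hs h)
  · intro g hg
    simpa [q_one] using q_eq g 1 (by simpa using hg)
  · obtain ⟨x, hx, hxB⟩ : ∃ x ∈ L, x ∉ B := by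
      by_contra! h1
      exact hB (by rw [← hBL, left_eq_sup]; exact h1)
    refine ⟨x, ?_⟩
    change q (s x) ≠ 0
    rw [q_eq x ⟨x, hx⟩ (by simp), Ne, q_eq_zero]
    exact fun h1 => hxB (hKB h1)

/-- Along a series, the first step at which `H` ceases to be a supplement yields the affine action.
Conversely, the elements that move `0` form a nonempty open set that misses `H`. -/
theorem not_isProDense_iff_exists_affine_hom {G : Type*} [Group G] {H : Subgroup G} :
    ¬ IsProDense FiniteSupersolvable H ↔ ∃ (p : ℕ) (_ : Fact p.Prime)
      (φ : G →* AffineGroup (ZMod p)), (∀ g ∈ H, (φ g).shift = 0) ∧ ∃ g, (φ g).shift ≠ 0 := by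
  constructor
  · intro h
    obtain ⟨N, hN, hHN⟩ : ∃ N : Subgroup G, PrimeChain N ∧ H ⊔ N ≠ ⊤ := by
      by_contra! h1
      exact h (isProDense_of_forall_primeChain h1)
    induction hN with
    | top => simp at hHN
    | @step K L hL hK hle hp ih =>
      by_cases hHL : H ⊔ L = ⊤
      · have := hL.normal
        have hpf : Fact (K.relIndex L).Prime := ⟨hp⟩
        obtain ⟨φ, hφ, hg⟩ := exists_affine_hom_of_supplement hle rfl (le_sup_right : K ≤ H ⊔ K) hHN
          (by rw [sup_assoc, sup_eq_right.mpr hle, hHL])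
        exact ⟨_, hpf, φ, fun g hg => hφ g (le_sup_left (a := H) hg), hg⟩
      · exact ih hHL
  · rintro ⟨p, hp, φ, hH, g, hg⟩ hd
    let : TopologicalSpace G := proTopology FiniteSupersolvable G
    let : TopologicalSpace (AffineGroup (ZMod p)) := ⊥
    have : DiscreteTopology (AffineGroup (ZMod p)) := ⟨rfl⟩
    have hφ : Continuous φ := by
      rw [continuous_iff_le_induced]
      exact iInf_le_of_le _ (iInf_le_of_le _ (iInf_le_of_le (AffineGroup.finiteSupersolvable p)
        (iInf_le _ φ)))
    have hopen : IsOpen (φ ⁻¹' {f | f.shift ≠ 0}) := (isOpen_discrete _).preimage hφ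
    obtain ⟨x, hx, hxH⟩ := Dense.inter_open_nonempty hd _ hopen ⟨g, hg⟩
    exact hx (hH x hxH)

/-! ### Polynomial systems: from characteristic zero to a prime field -/

open Polynomial in
/-- Schur: the values of a nonconstant integer polynomial have prime divisors outside any given
finite set of primes. -/
theorem Polynomial.exists_prime_not_dvd_aeval_eq_zero (f : ℤ[X]) (hdeg : 0 < f.natDegree)
    {N : ℤ} (hN : N ≠ 0) :
    ∃ p : ℕ, p.Prime ∧ ¬ (p : ℤ) ∣ N ∧ ∃ r : ZMod p, aeval r f = 0 := by
  by_cases hc : f.eval 0 = 0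
  · obtain ⟨p, hlt, hp⟩ := Nat.exists_infinite_primes (N.natAbs + 1)
    refine ⟨p, hp, fun h => ?_, 0, ?_⟩
    · have := Nat.le_of_dvd (Int.natAbs_pos.mpr hN) (Int.natCast_dvd.mp h)
      omega
    · have : aeval (algebraMap ℤ (ZMod p) 0) f = algebraMap ℤ (ZMod p) (f.eval 0) :=
        aeval_algebraMap_apply_eq_algebraMap_eval 0 f
      simpa [hc] using this
  set c := f.eval 0 with hcdef
  have hfin : {x : ℤ | f.eval x = c ∨ f.eval x = -c}.Finite := by
    have h1 : ∀ d : ℤ, {x : ℤ | f.eval x = d}.Finite := fun d => by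
      have h0 : f - C d ≠ 0 := fun h => by
        have := congrArg natDegree (sub_eq_zero.mp h)
        simp at this
        omega
      refine (f - C d).roots.toFinset.finite_toSet.subset fun x hx => ?_
      simp only [Finset.mem_coe, Multiset.mem_toFinset, mem_roots h0, IsRoot.def, eval_sub, eval_C]
      exact sub_eq_zero.mpr hx
    exact (h1 c).union (h1 (-c))
  have hinj : Function.Injective fun k : ℤ => c * N * k := fun a b h =>
    mul_left_cancel₀ (mul_ne_zero hc hN) h
  -- Modulo `cN` the value at `cNk` is `f(0) = c`, so it equals `c(1 + Nm)`. Avoiding the values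
  -- `±c` makes `1 + Nm` a nonunit, and its prime divisors do not divide `N`.
  obtain ⟨k, hk⟩ := (hfin.preimage hinj.injOn).exists_notMem
  have hk1 : c ∣ f.eval (c * N * k) - c ∧ c * N ∣ f.eval (c * N * k) - c := by
    have := f.sub_dvd_eval_sub (c * N * k) 0
    rw [sub_zero, ← hcdef] at this
    have h2 : c * N ∣ f.eval (c * N * k) - c := (Dvd.intro _ rfl).trans this
    exact ⟨(Dvd.intro _ rfl).trans h2, h2⟩
  obtain ⟨m, hm⟩ := hk1.2
  have hval : f.eval (c * N * k) = c * (1 + N * m) := by linear_combination hm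
  have hunit : (1 + N * m).natAbs ≠ 1 := fun h => hk <| by
    rcases Int.natAbs_eq_iff.mp h with h | h
    · left; simp only [hval, h]; simp
    · right; simp only [hval, h]; simp
  obtain ⟨p, hp, hdvd⟩ := Nat.exists_prime_and_dvd hunit
  have hdvd' : (p : ℤ) ∣ 1 + N * m := Int.natCast_dvd.mpr hdvd
  refine ⟨p, hp, fun h => ?_, ((c * N * k : ℤ) : ZMod p), ?_⟩
  · have : (p : ℤ) ∣ 1 := (dvd_add_left (h.mul_right m)).mp hdvd'
    exact hp.one_lt.ne' (Nat.dvd_one.mp (by exact_mod_cast this))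
  · have : aeval (algebraMap ℤ (ZMod p) (c * N * k)) f = algebraMap ℤ (ZMod p) (f.eval (c * N * k)) :=
      aeval_algebraMap_apply_eq_algebraMap_eval _ f
    rw [eq_intCast, eq_intCast] at this
    rw [this, hval, ZMod.intCast_zmod_eq_zero_iff_dvd _ p]
    exact hdvd'.mul_left c

/-- A polynomial with natural coefficients, written as the list of its monomials; a monomial is the
list of its variables. -/
abbrev NatPoly := List (List ℕ)

namespace NatPoly

variable {R R' : Type*} [CommSemiring R] [CommSemiring R']

def eval (T : ℕ → R) (P : NatPoly) : R := (P.map fun m => (m.map T).prod).sum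

theorem map_eval (f : R →+* R') (T : ℕ → R) (P : NatPoly) : eval (fun i => f (T i)) P = f
    (eval T P) := by
  simp [eval, map_list_sum, map_list_prod, Function.comp_def]

theorem eval_congr {T T' : ℕ → R} {P : NatPoly} (h : ∀ i ∈ P.flatten, T i = T' i) :
    eval T P = eval T' P := by
  unfold eval
  congr 1
  refine List.map_congr_left fun m hm => ?_
  congr 1
  exact List.map_congr_left fun i hi => h i (List.mem_flatten.mpr ⟨m, hm, hi⟩)

end NatPoly

/-- A finite system of equations between polynomials with natural coefficients. -/
abbrev PolySystem := List (NatPoly × NatPoly)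

namespace PolySystem

/-- The assignment `T` of values to the variables solves the system `S`. -/
def IsSolution {R : Type*} [CommSemiring R] (S : PolySystem) (T : ℕ → R) : Prop :=
  ∀ e ∈ S, e.1.eval T = e.2.eval T

/-- The list of the variables of a system. -/
def vars (S : PolySystem) : List ℕ := S.flatMap fun e => e.1.flatten ++ e.2.flatten

variable {S : PolySystem}

theorem IsSolution.map {R R' : Type*} [CommSemiring R] [CommSemiring R'] {T : ℕ → R}
    (h : S.IsSolution T)
    (f : R →+* R') : S.IsSolution fun i => f (T i) := fun e he => by
  rw [NatPoly.map_eval, NatPoly.map_eval, h e he]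

theorem IsSolution.of_map {R R' : Type*} [CommSemiring R] [CommSemiring R'] {T : ℕ → R}
    {f : R →+* R'}
    (hf : Function.Injective f) (h : S.IsSolution fun i => f (T i)) : S.IsSolution T := fun e he =>
  hf (by rw [← NatPoly.map_eval, ← NatPoly.map_eval, h e he])

theorem IsSolution.congr {R : Type*} [CommSemiring R] {T T' : ℕ → R} (h : S.IsSolution T)
    (hT : ∀ i ∈ S.vars, T i = T' i) : S.IsSolution T' := fun e he => by
  have h1 : e.1.eval T = e.1.eval T' := NatPoly.eval_congr fun i hi =>
    hT i (List.mem_flatMap.mpr ⟨e, he, List.mem_append_left _ hi⟩)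
  have h2 : e.2.eval T = e.2.eval T' := NatPoly.eval_congr fun i hi =>
    hT i (List.mem_flatMap.mpr ⟨e, he, List.mem_append_right _ hi⟩)
  rw [← h1, ← h2, h e he]

/-- The system `S` has a solution in the field with `p` elements for some prime `p`. -/
def SolvableModPrime (S : PolySystem) : Prop :=
  ∃ p : ℕ, p.Prime ∧ ∃ T : ℕ → ZMod p, S.IsSolution T

theorem exists_bound_vars (S : PolySystem) : ∃ n, ∀ i ∈ S.vars, i < n :=
  ⟨S.vars.sum + 1, fun _ hi => Nat.lt_succ_of_le (List.le_sum_of_mem hi)⟩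

open Polynomial in
theorem _root_.exists_integer_multiple_eq_aeval {K : Type*} [Field K] [CharZero K] {θ : K}
    (hθ : Algebra.adjoin ℚ {θ} = ⊤) (k : K) :
    ∃ N : ℤ, N ≠ 0 ∧ ∃ g : ℤ[X], aeval θ g = N * k := by
  obtain ⟨P, rfl⟩ : ∃ P : ℚ[X], aeval θ P = k := by
    have : k ∈ Algebra.adjoin ℚ {θ} := hθ ▸ Algebra.mem_top
    rwa [Algebra.adjoin_singleton_eq_range_aeval] at this
  obtain ⟨b, hb0, hb⟩ := IsLocalization.integerNormalization_spec (nonZeroDivisors ℤ) P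
  refine ⟨b, nonZeroDivisors.ne_zero hb0, IsLocalization.integerNormalization (nonZeroDivisors ℤ)
      P, ?_⟩
  rw [← aeval_map_algebraMap ℚ, hb]
  simp

-- Write `K = ℚ(θ)` with `θ` integral over `ℤ`, with minimal polynomial `f`. For a common
-- denominator `N`, the relevant values lie in `ℤ[θ][1/N] ≅ (ℤ[x]/f)[1/N]`, and a root of `f` modulo
-- a prime not dividing `N` gives a homomorphism from this ring to `𝔽_p`.
open Polynomial in
theorem IsSolution.solvableModPrime_of_finiteDimensional {K : Type*} [Field K] [CharZero K]
    [FiniteDimensional ℚ K] {T : ℕ → K} (h : S.IsSolution T) : S.SolvableModPrime := by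
  obtain ⟨α, hα⟩ := Field.exists_primitive_element ℚ K
  have hαalg : IsAlgebraic ℤ α :=
    (IsFractionRing.isAlgebraic_iff ℤ ℚ K).mpr (Algebra.IsAlgebraic.isAlgebraic α)
  obtain ⟨y, hy, hint⟩ := hαalg.exists_integral_multiple
  set θ : K := y • α with hθdef
  have hθ : Algebra.adjoin ℚ {θ} = ⊤ := by
    have h1 : Algebra.adjoin ℚ {α} = ⊤ := by
      rw [← IntermediateField.adjoin_simple_toSubalgebra_of_isAlgebraic
        (Algebra.IsAlgebraic.isAlgebraic α), hα, IntermediateField.top_toSubalgebra]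
    rw [eq_top_iff, ← h1, Algebra.adjoin_le_iff, Set.singleton_subset_iff]
    have h2 : α = (y : ℚ)⁻¹ • θ := by
      have : (y : K) ≠ 0 := by exact_mod_cast hy
      rw [hθdef, Algebra.smul_def]
      simp [this]
    rw [h2]
    exact Subalgebra.smul_mem _ (Algebra.self_mem_adjoin_singleton ℚ θ) _
  obtain ⟨n, hn⟩ := S.exists_bound_vars
  choose d hd g hg using fun i => exists_integer_multiple_eq_aeval hθ (T i)
  set N : ℤ := ∏ i ∈ Finset.range n, d i with hNdef
  have hN : N ≠ 0 := Finset.prod_ne_zero_iff.mpr fun i _ => hd i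
  let f := minpoly ℤ θ
  have hfd : 0 < f.natDegree := minpoly.natDegree_pos hint
  obtain ⟨p, hp, hpN, r, hr⟩ := f.exists_prime_not_dvd_aeval_eq_zero hfd hN
  have : Fact p.Prime := ⟨hp⟩
  let B := AdjoinRoot f
  let ι : B →+* K := AdjoinRoot.lift (algebraMap ℤ K) θ (minpoly.aeval ℤ θ)
  -- As `ℤ` is integrally closed, the integral minimal polynomial generates the kernel of evaluation
  -- at `θ`.
  have hι : Function.Injective ι := by
    rw [injective_iff_map_eq_zero]
    intro b hb
    obtain ⟨u, rfl⟩ := AdjoinRoot.mk_surjective b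
    exact AdjoinRoot.mk_eq_zero.mpr (minpoly.isIntegrallyClosed_dvd hint
        ((AdjoinRoot.lift_mk _ _).symm.trans hb))
  let A := Localization.Away (N : B)
  have hunit : IsUnit (ι N) := by
    rw [map_intCast]; exact (Int.cast_ne_zero.mpr hN).isUnit
  let κ : A →+* K := IsLocalization.Away.lift (N : B) hunit
  have hκι : ∀ b, κ (algebraMap B A b) = ι b := fun b => IsLocalization.Away.lift_eq _ hunit b
  have hκ : Function.Injective κ := by
    rw [injective_iff_map_eq_zero]
    intro a ha
    obtain ⟨k, b, hb⟩ := IsLocalization.Away.surj (N : B) a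
    have h1 : ι b = 0 := by rw [← hκι, ← hb, map_mul, ha, zero_mul]
    rw [hι (h1.trans (map_zero ι).symm), map_zero] at hb
    exact (IsUnit.mul_left_eq_zero ((IsLocalization.Away.algebraMap_isUnit (N : B)).pow k)).mp hb
  have hT : ∀ i, ∃ a : A, i < n → κ a = T i := fun i => by
    by_cases hi : i < n
    · obtain ⟨u, hu⟩ := Finset.dvd_prod_of_mem d (Finset.mem_range.mpr hi)
      obtain ⟨v, hv⟩ := IsLocalization.Away.algebraMap_isUnit (S := A) (N : B)
      -- Since `N = d i * u`, the value `T i = g i(θ) / d i` equals `g i(θ) * u / N`.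
      refine ⟨algebraMap B A (AdjoinRoot.mk f (g i) * (u : B)) * (↑(v⁻¹) : A), fun _ => ?_⟩
      have h1 : κ v = N := by rw [hv, hκι, map_intCast]
      have h2 : κ ↑(v⁻¹) * (N : K) = 1 := by rw [← h1, ← map_mul]; simp
      have h3 : ι (AdjoinRoot.mk f (g i)) = d i * T i := by
        rw [← hg]; exact AdjoinRoot.lift_mk _ _
      rw [map_mul, hκι, map_mul, h3, map_intCast]
      have h4 : (N : K) = d i * u := by rw [← hNdef] at hu; exact_mod_cast hu
      rw [h4] at h2
      linear_combination (T i) * h2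
    · exact ⟨0, fun h => absurd h hi⟩
  choose T' hT' using hT
  have hsol : S.IsSolution T' := (h.congr fun i hi => (hT' i (hn i hi)).symm).of_map hκ
  let ψ : B →+* ZMod p := AdjoinRoot.lift (algebraMap ℤ (ZMod p)) r hr
  have hψ : IsUnit (ψ N) := by
    rw [map_intCast, isUnit_iff_ne_zero, Ne, ZMod.intCast_zmod_eq_zero_iff_dvd]
    exact hpN
  exact ⟨p, hp, _, hsol.map (IsLocalization.Away.lift (N : B) hψ : A →+* ZMod p)⟩

/-- Zariski's lemma: a field that is finitely generated as a `ℚ`-algebra is finite over `ℚ`. -/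
theorem IsSolution.solvableModPrime_of_surjective {K σ : Type*} [Field K] [CharZero K] [Finite σ]
    {T : ℕ → K} (h : S.IsSolution T) {f : MvPolynomial σ ℚ →+* K} (hf : Function.Surjective f) :
    S.SolvableModPrime := by
  have : Algebra.FiniteType ℚ K := .of_surjective f.toRatAlgHom hf
  have : FiniteDimensional ℚ K := finite_of_finite_type_of_isJacobsonRing ℚ K
  exact h.solvableModPrime_of_finiteDimensional

/-- Finitely many values matter, and they generate a finitely generated `ℚ`-algebra; the solution
passes to a residue field of that algebra. -/
theorem IsSolution.solvableModPrime_of_charZero {K : Type*} [Field K] [CharZero K]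
    {T : ℕ → K} (h : S.IsSolution T) : S.SolvableModPrime := by
  obtain ⟨n, hn⟩ := S.exists_bound_vars
  let ev : MvPolynomial (Fin n) ℚ →ₐ[ℚ] K := MvPolynomial.aeval fun i => T i
  let A := MvPolynomial (Fin n) ℚ ⧸ RingHom.ker ev
  let ev' : A →+* K := RingHom.kerLift ev.toRingHom
  have hev' : Function.Injective ev' := RingHom.kerLift_injective _
  let T' : ℕ → A := fun i => if hi : i < n then Ideal.Quotient.mk _ (MvPolynomial.X ⟨i, hi⟩) else 0
  have hT' : S.IsSolution T' := by
    refine (h.congr fun i hi => ?_).of_map hev'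
    simp only [T', hn i hi, dif_pos]
    exact (MvPolynomial.aeval_X (R := ℚ) (fun i : Fin n => T i) ⟨i, hn i hi⟩).symm
  have : Nontrivial A := ev'.domain_nontrivial
  obtain ⟨M, hM⟩ := Ideal.exists_maximal A
  let _ := Ideal.Quotient.field M
  have : CharZero (A ⧸ M) := algebraRat.charZero _
  exact (hT'.map (Ideal.Quotient.mk M)).solvableModPrime_of_surjective
    (f := (Ideal.Quotient.mk M).comp (Ideal.Quotient.mk (RingHom.ker ev)))
    (Ideal.Quotient.mk_surjective.comp Ideal.Quotient.mk_surjective)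

/-- Inverting the positive integers leaves a nonzero ring, whose residue fields have characteristic
zero. -/
theorem IsSolution.solvableModPrime_of_forall_ne_zero {R : Type*} [CommRing R] {T : ℕ → R}
    (h : S.IsSolution T) (hR : ∀ N : ℕ, N ≠ 0 → (N : R) ≠ 0) : S.SolvableModPrime := by
  let P : Submonoid R := (nonZeroDivisors ℕ).map (Nat.castRingHom R)
  have hP : (0 : R) ∉ P := by
    rintro ⟨N, hN, h0⟩
    exact hR N (nonZeroDivisors.ne_zero hN) h0
  have : Nontrivial (Localization P) := by
    rw [← not_subsingleton_iff_nontrivial, IsLocalization.subsingleton_iff (M := P)]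
    exact hP
  obtain ⟨M, hM⟩ := Ideal.exists_maximal (Localization P)
  let _ := Ideal.Quotient.field M
  let f : R →+* Localization P ⧸ M := (Ideal.Quotient.mk M).comp (algebraMap R (Localization P))
  have : CharZero (Localization P ⧸ M) := by
    refine charZero_of_inj_zero fun N hN => ?_
    by_contra hN0
    have hu : IsUnit (algebraMap R (Localization P) N) :=
      IsLocalization.map_units _ (⟨N, N, mem_nonZeroDivisors_of_ne_zero hN0, rfl⟩ : P)
    have := hu.map (Ideal.Quotient.mk M)
    rw [map_natCast, map_natCast, hN] at this
    exact not_isUnit_zero this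
  exact (h.map f).solvableModPrime_of_charZero

end PolySystem

/-! ### Finite certificates of unsolvability -/

namespace NatPoly

/-- Equality of polynomials: every monomial occurs equally often, up to the order of its
variables. -/
def Equiv (P Q : NatPoly) : Prop :=
  ∀ m, P.countP (fun m' => m'.isPerm m) = Q.countP (fun m' => m'.isPerm m)

theorem count_map_ofList (P : NatPoly) (m : List ℕ) :
    (P.map Multiset.ofList).count (m : Multiset ℕ) = P.countP (fun m' => m'.isPerm m) := by
  rw [List.count, List.countP_map]
  congr 1
  funext m'
  rw [Bool.eq_iff_iff]
  simp [List.isPerm_iff]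

theorem equiv_iff_perm {P Q : NatPoly} :
    P.Equiv Q ↔ (P.map Multiset.ofList).Perm (Q.map Multiset.ofList) := by
  rw [List.perm_iff_count]
  constructor
  · intro h s
    induction s using Quotient.inductionOn with | h m => ?_
    exact (count_map_ofList P m).trans ((h m).trans (count_map_ofList Q m).symm)
  · intro h m
    rw [← count_map_ofList, ← count_map_ofList, h]

section

variable {R : Type*} [CommSemiring R]

theorem Equiv.eval_eq {P Q : NatPoly} (h : P.Equiv Q) (T : ℕ → R) : P.eval T = Q.eval T := by
  have := ((equiv_iff_perm.mp h).map fun s : Multiset ℕ => (s.map T).prod).sum_eq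
  simpa [eval, Function.comp_def] using this

/-- The product of a monomial and a polynomial. -/
def mulMonomial (m : List ℕ) (P : NatPoly) : NatPoly := P.map fun m' => m ++ m'

@[simp] theorem eval_nil (T : ℕ → R) : eval T [] = 0 := rfl

@[simp] theorem eval_cons (T : ℕ → R) (m : List ℕ) (P : NatPoly) :
    eval T (m :: P) = (m.map T).prod + eval T P := by simp [eval]

@[simp] theorem eval_append (T : ℕ → R) (P Q : NatPoly) :
    eval T (P ++ Q) = eval T P + eval T Q := by simp [eval]

@[simp] theorem eval_mulMonomial (T : ℕ → R) (m : List ℕ) (P : NatPoly) :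
    eval T (mulMonomial m P) = (m.map T).prod * eval T P := by
  simp [eval, mulMonomial, Function.comp_def, List.sum_map_mul_left]

@[simp] theorem eval_replicate_nil (T : ℕ → R) (n : ℕ) : eval T (List.replicate n []) = n := by
  simp [eval]

theorem eval_flatMap {α : Type*} (T : ℕ → R) (l : List α) (f : α → NatPoly) :
    eval T (l.flatMap f) = (l.map fun a => eval T (f a)).sum := by
  induction l with
  | nil => rfl
  | cons a l ih => simp [ih]

end

theorem coeff_eval_X (P : NatPoly) (s : Multiset ℕ) :
    (P.eval (MvPolynomial.X : ℕ → MvPolynomial ℕ ℤ)).coeff (Multiset.toFinsupp s) =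
      (P.map Multiset.ofList).count s := by
  induction P with
  | nil => simp
  | cons m P ih =>
    have hm : (m.map (MvPolynomial.X : ℕ → MvPolynomial ℕ ℤ)).prod =
        MvPolynomial.monomial (Multiset.toFinsupp (m : Multiset ℕ)) 1 := by
      induction m with
      | nil => simp
      | cons i m ih =>
        rw [List.map_cons, List.prod_cons, ih, MvPolynomial.X, MvPolynomial.monomial_mul,
          ← Multiset.cons_coe, ← Multiset.singleton_add, map_add, Multiset.toFinsupp_singleton,
              mul_one]
    rw [eval_cons, MvPolynomial.coeff_add, ih, hm, MvPolynomial.coeff_monomial, List.map_cons,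
        List.count_cons]
    simp only [EmbeddingLike.apply_eq_iff_eq, beq_iff_eq]
    push_cast
    rw [add_comm]

/-- Over `ℤ` the coefficient of a monomial recovers how often it is listed, so an identity of
polynomials is a combinatorial identity of lists. -/
theorem equiv_of_eval_X_eq {P Q : NatPoly}
    (h : P.eval (MvPolynomial.X : ℕ → MvPolynomial ℕ ℤ) = Q.eval MvPolynomial.X) : P.Equiv Q := by
  rw [equiv_iff_perm, List.perm_iff_count]
  intro s
  have := coeff_eval_X P s
  rw [h, coeff_eval_X] at this
  exact_mod_cast this.symm

end NatPoly

namespace PolySystem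

variable {S : PolySystem}

/-- A list of multiples of equations of the system. -/
abbrev Combination := List (List ℕ × (NatPoly × NatPoly))

namespace Combination

def lhs (c : Combination) : NatPoly := c.flatMap fun r => r.2.1.mulMonomial r.1

def rhs (c : Combination) : NatPoly := c.flatMap fun r => r.2.2.mulMonomial r.1

end Combination

/-- The combination `c` of the equations of `S`, which may be used in both directions, derives
`N = 0`. -/
def Derives (S : PolySystem) (N : ℕ) (c : Combination) : Prop :=
  (∀ r ∈ c, r.2 ∈ S ∨ r.2.swap ∈ S) ∧ NatPoly.Equiv (List.replicate N [] ++ c.lhs) c.rhs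

theorem Derives.natCast_eq_zero {R : Type*} [CommRing R] {N : ℕ} {c : Combination}
    (h : S.Derives N c)
    {T : ℕ → R} (hT : S.IsSolution T) : (N : R) = 0 := by
  have h1 := h.2.eval_eq T
  have h2 : c.lhs.eval T = c.rhs.eval T := by
    unfold Combination.lhs Combination.rhs
    rw [NatPoly.eval_flatMap, NatPoly.eval_flatMap]
    congr 1
    refine List.map_congr_left fun r hr => ?_
    rw [NatPoly.eval_mulMonomial, NatPoly.eval_mulMonomial]
    rcases h.1 r hr with h3 | h3
    · rw [hT _ h3]
    · exact congrArg _ (hT _ h3).symm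
  rw [NatPoly.eval_append, NatPoly.eval_replicate_nil, h2] at h1
  exact add_eq_right.mp h1

open MvPolynomial in
/-- The ideal generated by the differences of the two sides of the equations. -/
noncomputable def ideal (S : PolySystem) : Ideal (MvPolynomial ℕ ℤ) :=
  Ideal.span {u | ∃ e ∈ S, u = e.1.eval X - e.2.eval X}

open MvPolynomial in
/-- The differences of the two sides of the combinations of equations. -/
noncomputable def combinations (S : PolySystem) : AddSubgroup (MvPolynomial ℕ ℤ) where
  carrier := {u | ∃ c : Combination, (∀ r ∈ c, r.2 ∈ S ∨ r.2.swap ∈ S) ∧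
    u = c.rhs.eval X - c.lhs.eval X}
  zero_mem' := ⟨[], by simp, by simp [Combination.rhs, Combination.lhs]⟩
  add_mem' := by
    rintro _ _ ⟨c, hc, rfl⟩ ⟨d, hd, rfl⟩
    refine ⟨c ++ d, fun r hr => (List.mem_append.mp hr).elim (hc r) (hd r), ?_⟩
    simp [Combination.rhs, Combination.lhs]
    ring
  neg_mem' := by
    rintro _ ⟨c, hc, rfl⟩
    refine ⟨c.map fun r => (r.1, r.2.swap), ?_, ?_⟩
    · simp only [List.mem_map]
      rintro _ ⟨r, hr, rfl⟩
      simpa using (hc r hr).symm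
    · simp [Combination.rhs, Combination.lhs, List.flatMap_map]

-- Combinations are closed under multiplication by variables and under integer multiples, hence by
-- arbitrary polynomials. Reversing equations supplies the negative coefficients that lists of
-- monomials lack.
open MvPolynomial in
theorem ideal_le_combinations {u : MvPolynomial ℕ ℤ} (hu : u ∈ S.ideal) : u ∈ S.combinations := by
  have hX : ∀ v ∈ S.combinations, ∀ i, v * X i ∈ S.combinations := by
    rintro _ ⟨c, hc, rfl⟩ i
    refine ⟨c.map fun r => (i :: r.1, r.2), ?_, ?_⟩
    · simp only [List.mem_map]
      rintro _ ⟨r, hr, rfl⟩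
      exact hc r hr
    · simp only [Combination.rhs, Combination.lhs, List.flatMap_map, NatPoly.eval_flatMap,
        NatPoly.eval_mulMonomial, List.map_cons, List.prod_cons, mul_assoc, List.sum_map_mul_left]
      ring
  refine Submodule.span_induction ?_ (zero_mem _) (fun _ _ _ _ => add_mem) (fun q v _ hv => ?_) hu
  · rintro _ ⟨e, he, rfl⟩
    refine ⟨[([], e.swap)], by simpa using Or.inr he, ?_⟩
    simp [Combination.rhs, Combination.lhs]
  · rw [smul_eq_mul]
    induction q using MvPolynomial.induction_on with
    | C a => rw [C_mul']; exact zsmul_mem hv a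
    | add q r hq hr => rw [add_mul]; exact add_mem hq hr
    | mul_X q i hq => rw [mul_right_comm]; exact hX _ hq i

open MvPolynomial in
theorem exists_derives_of_natCast_mem_ideal {N : ℕ} (hN : (N : MvPolynomial ℕ ℤ) ∈ S.ideal) :
    ∃ c, S.Derives N c := by
  obtain ⟨c, hc, h⟩ := ideal_le_combinations hN
  refine ⟨c, hc, NatPoly.equiv_of_eval_X_eq ?_⟩
  simp [h]

/-- A refutation of solvability modulo primes: a derivation of `N = 0`, and the absence of
solutions modulo the primes up to `N`. -/
theorem not_solvableModPrime_iff : ¬ S.SolvableModPrime ↔ ∃ (N : ℕ) (c : Combination), N ≠ 0 ∧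
    S.Derives N c ∧ ∀ p < N + 1, p.Prime → ¬ ∃ T : ℕ → ZMod p, S.IsSolution T := by
  constructor
  · intro h
    obtain ⟨N, hN, hmem⟩ : ∃ N : ℕ, N ≠ 0 ∧ (N : MvPolynomial ℕ ℤ) ∈ S.ideal := by
      by_contra! h1
      -- The classes of the variables are a generic solution in `ℤ[X]/I`, where now no positive
      -- integer vanishes.
      have hsol : S.IsSolution fun i => Ideal.Quotient.mk S.ideal (MvPolynomial.X i) := fun e he => by
        rw [NatPoly.map_eval, NatPoly.map_eval, Ideal.Quotient.eq]
        exact Ideal.subset_span ⟨e, he, rfl⟩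
      refine h (hsol.solvableModPrime_of_forall_ne_zero fun N hN h0 => h1 N hN ?_)
      rwa [← map_natCast (Ideal.Quotient.mk S.ideal), Ideal.Quotient.eq_zero_iff_mem] at h0
    obtain ⟨c, hc⟩ := exists_derives_of_natCast_mem_ideal hmem
    exact ⟨N, c, hN, hc, fun p _ hp hT => h ⟨p, hp, hT⟩⟩
  · rintro ⟨N, c, hN, hc, hp⟩ ⟨p, hpp, T, hT⟩
    have h0 := hc.natCast_eq_zero hT
    rw [ZMod.natCast_eq_zero_iff] at h0
    exact hp p (Nat.lt_succ_of_le (Nat.le_of_dvd (Nat.pos_of_ne_zero hN) h0)) hpp ⟨T, hT⟩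

end PolySystem

/-! ### Computability of the search and of the certificates -/

section Computability

variable {α β γ σ : Type*} [Primcodable α] [Primcodable β] [Primcodable γ] [Primcodable σ]

theorem PrimrecRel.forall_mem {f : α → List β} {R : α → β → Prop} (hf : Primrec f)
    (hR : PrimrecRel R) :
    PrimrecPred fun a => ∀ b ∈ f a, R a b :=
  hR.swap.forall_mem_list.comp hf Primrec.id

theorem PrimrecRel.exists_mem {f : α → List β} {R : α → β → Prop} (hf : Primrec f)
    (hR : PrimrecRel R) :
    PrimrecPred fun a => ∃ b ∈ f a, R a b :=
  hR.swap.exists_mem_list.comp hf Primrec.id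

theorem PrimrecPred.imp {p q : α → Prop} (hp : PrimrecPred p) (hq : PrimrecPred q) :
    PrimrecPred fun a => p a → q a :=
  (hp.not.or hq).of_eq fun _ => imp_iff_not_or.symm

theorem REPred.exists {R : α → β → Prop} (hR : PrimrecRel R) : REPred fun a => ∃ b, R a b := by
  classical
  -- Unbounded search over codes of witnesses; a number that codes nothing counts as a failure.
  let q : α → ℕ → Bool := fun a n =>
    ((Encodable.decode n : Option β).map fun b => decide (R a b)).getD false
  have hq : Primrec₂ q := Primrec.option_getD.comp
    (Primrec.option_map (Primrec.decode.comp Primrec.snd)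
      (hR.decide.comp (Primrec.fst.comp Primrec.fst) Primrec.snd)) (Primrec.const false)
  refine (Partrec.rfind (p := fun a n => Part.some (q a n)) hq.to_comp.partrec₂).dom_re.of_eq
    fun a => ?_
  refine Nat.rfind_dom'.trans ?_
  simp only [Part.mem_some_iff]
  constructor
  · rintro ⟨n, hn, -⟩
    cases h : (Encodable.decode n : Option β) with
    | none => simp [q, h] at hn
    | some b => exact ⟨b, by simpa [q, h] using hn.symm⟩
  · rintro ⟨b, hb⟩
    exact ⟨Encodable.encode b, by simp [q, hb], fun _ => trivial⟩

theorem Primrec.list_sum : Primrec (List.sum : List ℕ → ℕ) :=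
  (Primrec.list_foldr Primrec.id (Primrec.const 0)
    (Primrec.nat_add.comp (Primrec.fst.comp Primrec.snd) (Primrec.snd.comp Primrec.snd)).to₂).of_eq
    fun _ => rfl

theorem Primrec.list_prod : Primrec (List.prod : List ℕ → ℕ) :=
  (Primrec.list_foldr Primrec.id (Primrec.const 1)
    (Primrec.nat_mul.comp (Primrec.fst.comp Primrec.snd) (Primrec.snd.comp Primrec.snd)).to₂).of_eq
    fun _ => rfl

theorem PrimrecRel.list_countP {R : β → α → Prop} [DecidableRel R] (hR : PrimrecRel R) :
    Primrec₂ fun (l : List β) (a : α) => l.countP fun b => decide (R b a) :=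
  (Primrec.list_length.comp₂ hR.listFilter).of_eq fun l a => by rw [List.countP_eq_length_filter]

theorem Primrec.list_count [DecidableEq α] : Primrec₂ fun (l : List α) (a : α) => l.count a :=
  (PrimrecRel.list_countP Primrec.eq).of_eq fun l a => by
    rw [List.count]; congr 1

theorem PrimrecRel.list_perm : PrimrecRel (List.Perm : List α → List α → Prop) := by
  classical
  refine (PrimrecRel.forall_mem (α := List α × List α)
    (R := fun p a => p.1.count a = p.2.count a)
    (Primrec.list_append.comp Primrec.fst Primrec.snd)
    (Primrec.eq.comp (Primrec.list_count.comp (Primrec.fst.comp Primrec.fst) Primrec.snd)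
      (Primrec.list_count.comp (Primrec.snd.comp Primrec.fst) Primrec.snd))).of_eq fun p => ?_
  rw [List.perm_iff_count]
  refine ⟨fun h a => ?_, fun h a _ => h a⟩
  by_cases ha : a ∈ p.1 ++ p.2
  · exact h a ha
  · rw [List.mem_append, not_or] at ha
    rw [List.count_eq_zero.mpr ha.1, List.count_eq_zero.mpr ha.2]

theorem PrimrecPred.nat_prime : PrimrecPred Nat.Prime := by
  refine ((Primrec.nat_le.comp (Primrec.const 2) Primrec.id).and
    (PrimrecRel.forall_mem (R := fun p m => p % m = 0 → m = 1) Primrec.list_range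
      ((Primrec.eq.comp (Primrec.nat_mod.comp Primrec.fst Primrec.snd) (Primrec.const 0)).imp
        (Primrec.eq.comp Primrec.snd (Primrec.const 1))))).of_eq fun p => ?_
  simp only [id, List.mem_range, Nat.prime_def_lt, Nat.dvd_iff_mod_eq_zero]

end Computability

namespace NatPoly

/-- Makes the quantifier bounded: a monomial that permutes no listed one has count zero on both
sides. -/
theorem equiv_iff_forall_mem {P Q : NatPoly} : P.Equiv Q ↔
    ∀ m ∈ P ++ Q, P.countP (fun m' => m'.isPerm m) = Q.countP (fun m' => m'.isPerm m) := by
  refine ⟨fun h m _ => h m, fun h m => ?_⟩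
  by_cases hm : ∃ m' ∈ P ++ Q, m'.Perm m
  · obtain ⟨m', hm', hp⟩ := hm
    rw [← count_map_ofList, ← count_map_ofList, ← Multiset.coe_eq_coe.mpr hp, count_map_ofList,
      count_map_ofList, h m' hm']
  · push Not at hm
    have h1 : ∀ P' : NatPoly, (∀ m' ∈ P', ¬ m'.Perm m) → P'.countP (fun m' => m'.isPerm m) = 0 := by
      intro P' hP'
      rw [List.countP_eq_zero]
      intro m' hm' hp
      exact hP' m' hm' (List.isPerm_iff.mp hp)
    rw [h1 P fun m' h' => hm m' (List.mem_append_left _ h'),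
      h1 Q fun m' h' => hm m' (List.mem_append_right _ h')]

theorem primrecRel_equiv : PrimrecRel NatPoly.Equiv := by
  have hc : Primrec₂ fun (P : NatPoly) (m : List ℕ) => P.countP fun m' => m'.isPerm m :=
    PrimrecRel.list_perm.list_countP.of_eq fun P m => by
      congr 1; funext m'; rw [Bool.eq_iff_iff]; simp [List.isPerm_iff]
  exact (PrimrecRel.forall_mem (α := NatPoly × NatPoly)
    (R := fun p m => p.1.countP (fun m' => m'.isPerm m) = p.2.countP (fun m' => m'.isPerm m))
    (Primrec.list_append.comp Primrec.fst Primrec.snd)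
    (Primrec.eq.comp (hc.comp (Primrec.fst.comp Primrec.fst) Primrec.snd)
      (hc.comp (Primrec.snd.comp Primrec.fst) Primrec.snd))).of_eq fun p =>
          equiv_iff_forall_mem.symm

/-- Evaluation at a finite list of values, continued by zeros. -/
theorem primrec_eval : Primrec₂ fun (l : List ℕ) (P : NatPoly) => P.eval fun i => l.getD i 0 := by
  have hm : Primrec₂ fun (l : List ℕ) (m : List ℕ) => (m.map fun i => l.getD i 0).prod :=
    Primrec.list_prod.comp (Primrec.list_map Primrec.snd
      ((Primrec.list_getD 0).comp (Primrec.fst.comp Primrec.fst) Primrec.snd).to₂)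
  exact Primrec.list_sum.comp (Primrec.list_map Primrec.snd
    (hm.comp (Primrec.fst.comp Primrec.fst) Primrec.snd).to₂)

theorem primrec_mulMonomial : Primrec₂ mulMonomial :=
  Primrec.list_map Primrec.snd
    (Primrec.list_append.comp (Primrec.fst.comp Primrec.fst) Primrec.snd).to₂

end NatPoly

/-- The lists of length `n` with entries less than `p`. -/
def boundedLists (p : ℕ) : ℕ → List (List ℕ)
  | 0 => [[]]
  | n + 1 => (boundedLists p n).flatMap fun l => (List.range p).map fun i => i :: l

theorem mem_boundedLists {p n : ℕ} {l : List ℕ} :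
    l ∈ boundedLists p n ↔ l.length = n ∧ ∀ i ∈ l, i < p := by
  induction n generalizing l with
  | zero => simp +contextual [boundedLists]
  | succ n ih =>
    cases l with
    | nil => simp [boundedLists]
    | cons i l => simp [boundedLists, ih]; tauto

theorem primrec_boundedLists : Primrec₂ boundedLists := by
  refine (Primrec.nat_rec (f := fun _ : ℕ => [[]])
    (g := fun p (q : ℕ × List (List ℕ)) => q.2.flatMap fun l => (List.range p).map fun i => i :: l)
    (Primrec.const _) ?_).of_eq fun p n => ?_
  · refine Primrec.list_flatMap (Primrec.snd.comp Primrec.snd) ?_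
    refine Primrec.list_map (Primrec.list_range.comp (Primrec.fst.comp Primrec.fst)) ?_
    exact Primrec.list_cons.comp Primrec.snd (Primrec.snd.comp Primrec.fst)
  · induction n with
    | zero => rfl
    | succ n ih => simp only [boundedLists, ih]

namespace PolySystem

/-- The list `l`, continued by zeros, solves `S` modulo `p`. -/
def IsListSolution (S : PolySystem) (p : ℕ) (l : List ℕ) : Prop :=
  ∀ e ∈ S, e.1.eval (fun i => l.getD i 0) % p = e.2.eval (fun i => l.getD i 0) % p

theorem isSolution_getD_iff {S : PolySystem} {p : ℕ} {l : List ℕ} :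
    S.IsSolution (fun i => (l.getD i 0 : ZMod p)) ↔ S.IsListSolution p l := by
  refine forall₂_congr fun e _ => ?_
  rw [← ZMod.natCast_eq_natCast_iff']
  have := fun P : NatPoly => P.map_eval (Nat.castRingHom (ZMod p)) fun i => l.getD i 0
  simp only [Nat.coe_castRingHom] at this
  rw [this, this]

/-- Only the variables that occur matter, and their sum is a computable bound for each, so finitely
many lists of residues suffice. -/
theorem exists_isSolution_iff {S : PolySystem} {p : ℕ} (hp : p.Prime) :
    (∃ T : ℕ → ZMod p, S.IsSolution T) ↔
      ∃ l ∈ boundedLists p (S.vars.sum + 1), S.IsListSolution p l := by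
  have : NeZero p := ⟨hp.ne_zero⟩
  constructor
  · rintro ⟨T, hT⟩
    refine ⟨(List.range (S.vars.sum + 1)).map fun i => (T i).val, mem_boundedLists.mpr
        ⟨by simp, ?_⟩, ?_⟩
    · simp only [List.mem_map]
      rintro _ ⟨i, -, rfl⟩
      exact ZMod.val_lt _
    · refine isSolution_getD_iff.mp (hT.congr fun i hi => ?_)
      have : i < S.vars.sum + 1 := Nat.lt_succ_of_le (List.le_sum_of_mem hi)
      simp [List.getD, this]
  · rintro ⟨l, -, hl⟩
    exact ⟨_, isSolution_getD_iff.mpr hl⟩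

theorem primrecPred_isListSolution :
    PrimrecPred fun q : PolySystem × ℕ × List ℕ => q.1.IsListSolution q.2.1 q.2.2 := by
  refine PrimrecRel.forall_mem Primrec.fst (R := fun (q : PolySystem × ℕ × List ℕ)
      (e : NatPoly × NatPoly) =>
    e.1.eval (fun i => q.2.2.getD i 0) % q.2.1 = e.2.eval (fun i => q.2.2.getD i 0) % q.2.1) ?_
  have hl : Primrec fun a : (PolySystem × ℕ × List ℕ) × NatPoly × NatPoly => a.1.2.2 :=
    Primrec.snd.comp (Primrec.snd.comp Primrec.fst)
  have hp : Primrec fun a : (PolySystem × ℕ × List ℕ) × NatPoly × NatPoly => a.1.2.1 :=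
    Primrec.fst.comp (Primrec.snd.comp Primrec.fst)
  exact Primrec.eq.comp
    (Primrec.nat_mod.comp (NatPoly.primrec_eval.comp hl (Primrec.fst.comp Primrec.snd)) hp)
    (Primrec.nat_mod.comp (NatPoly.primrec_eval.comp hl (Primrec.snd.comp Primrec.snd)) hp)

theorem primrec_vars : Primrec vars :=
  Primrec.list_flatMap Primrec.id (Primrec.list_append.comp
    (Primrec.list_flatten.comp (Primrec.fst.comp Primrec.snd))
    (Primrec.list_flatten.comp (Primrec.snd.comp Primrec.snd))).to₂

theorem primrecRel_exists_isListSolution : PrimrecRel fun (S : PolySystem) (p : ℕ) =>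
    ∃ l ∈ boundedLists p (S.vars.sum + 1), S.IsListSolution p l :=
  PrimrecRel.exists_mem (α := PolySystem × ℕ) (R := fun q l => q.1.IsListSolution q.2 l)
    (primrec_boundedLists.comp Primrec.snd
      (Primrec.succ.comp (Primrec.list_sum.comp (primrec_vars.comp Primrec.fst))))
    (primrecPred_isListSolution.comp
      ((Primrec.fst.comp Primrec.fst).pair ((Primrec.snd.comp Primrec.fst).pair Primrec.snd)))

theorem rePred_solvableModPrime : REPred SolvableModPrime := by
  refine (REPred.exists (R := fun (S : PolySystem) (p : ℕ) => p.Prime ∧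
    ∃ l ∈ boundedLists p (S.vars.sum + 1), S.IsListSolution p l) ?_).of_eq fun S => ?_
  · exact (PrimrecPred.nat_prime.comp Primrec.snd).and primrecRel_exists_isListSolution
  · exact exists_congr fun p => and_congr_right fun hp => (exists_isSolution_iff hp).symm

theorem Combination.primrec_lhs : Primrec Combination.lhs :=
  Primrec.list_flatMap Primrec.id (NatPoly.primrec_mulMonomial.comp (Primrec.fst.comp Primrec.snd)
    (Primrec.fst.comp (Primrec.snd.comp Primrec.snd))).to₂

theorem Combination.primrec_rhs : Primrec Combination.rhs :=
  Primrec.list_flatMap Primrec.id (NatPoly.primrec_mulMonomial.comp (Primrec.fst.comp Primrec.snd)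
    (Primrec.snd.comp (Primrec.snd.comp Primrec.snd))).to₂

theorem primrecRel_mem {α : Type*} [Primcodable α] : PrimrecRel fun (a : α) (l : List α) => a ∈ l :=
  (PrimrecRel.exists_mem (α := α × List α) (R := fun q b => b = q.1) Primrec.snd
    (Primrec.eq.comp Primrec.snd (Primrec.fst.comp Primrec.fst))).of_eq fun q => by simp

theorem primrec_replicate_nil : Primrec fun n => (List.replicate n [] : NatPoly) :=
  (Primrec.list_map Primrec.list_range (Primrec.const []).to₂).of_eq fun n => by
    simp [List.map_const']

theorem primrecPred_derives :
    PrimrecPred fun q : PolySystem × ℕ × Combination => q.1.Derives q.2.1 q.2.2 := by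
  have hc : Primrec fun q : PolySystem × ℕ × Combination => q.2.2 := Primrec.snd.comp Primrec.snd
  refine PrimrecPred.and (PrimrecRel.forall_mem hc
    (R := fun (q : PolySystem × ℕ × Combination) (r : List ℕ × NatPoly × NatPoly) =>
      r.2 ∈ q.1 ∨ r.2.swap ∈ q.1) ?_) ?_
  · have hS : Primrec fun a : (PolySystem × ℕ × Combination) × List ℕ × NatPoly × NatPoly => a.1.1 :=
      Primrec.fst.comp Primrec.fst
    have he : Primrec fun a : (PolySystem × ℕ × Combination) × List ℕ × NatPoly × NatPoly => a.2.2 :=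
      Primrec.snd.comp Primrec.snd
    exact (primrecRel_mem.comp he hS).or
      (primrecRel_mem.comp ((Primrec.snd.comp he).pair (Primrec.fst.comp he)) hS)
  · exact NatPoly.primrecRel_equiv.comp
      (Primrec.list_append.comp (primrec_replicate_nil.comp (Primrec.fst.comp Primrec.snd))
        (Combination.primrec_lhs.comp hc))
      (Combination.primrec_rhs.comp hc)

theorem rePred_not_solvableModPrime : REPred fun S : PolySystem => ¬ S.SolvableModPrime := by
  refine (REPred.exists (α := PolySystem) (β := ℕ × Combination)
    (R := fun S w => w.1 ≠ 0 ∧ S.Derives w.1 w.2 ∧ ∀ p ∈ List.range (w.1 + 1), p.Prime →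
      ¬ ∃ l ∈ boundedLists p (S.vars.sum + 1), S.IsListSolution p l) ?_).of_eq fun S => ?_
  · refine PrimrecPred.and ?_ (PrimrecPred.and ?_ ?_)
    · exact (Primrec.eq.comp (Primrec.fst.comp Primrec.snd) (Primrec.const 0)).not
    · exact primrecPred_derives
    · refine PrimrecRel.forall_mem (α := PolySystem × ℕ × Combination)
        (R := fun q p => p.Prime →
          ¬ ∃ l ∈ boundedLists p (q.1.vars.sum + 1), q.1.IsListSolution p l)
        (Primrec.list_range.comp (Primrec.succ.comp (Primrec.fst.comp Primrec.snd))) ?_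
      exact (PrimrecPred.nat_prime.comp Primrec.snd).imp
        (primrecRel_exists_isListSolution.comp (Primrec.fst.comp Primrec.fst) Primrec.snd).not
  · rw [not_solvableModPrime_iff, Prod.exists]
    refine exists₂_congr fun N c => and_congr_right fun _ => and_congr_right fun _ =>
      forall_congr' fun p => ?_
    rw [List.mem_range]
    exact forall₂_congr fun _ hp => not_congr (exists_isSolution_iff hp).symm

/-- It is decidable whether a polynomial system has a solution modulo some prime. -/
theorem computablePred_solvableModPrime : ComputablePred SolvableModPrime :=
  ComputablePred.computable_iff_re_compl_re'.mpr
      ⟨rePred_solvableModPrime, rePred_not_solvableModPrime⟩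

end PolySystem

/-! ### Words, renaming and affine interpretations -/

theorem FreeGroupBasis.closure_range {X F : Type*} [Group F] (b : FreeGroupBasis X F) :
    Subgroup.closure (Set.range b) = ⊤ := by
  let S := Subgroup.closure (Set.range b)
  let φ : F →* S := b.lift fun x => ⟨b x, Subgroup.subset_closure ⟨x, rfl⟩⟩
  have h : S.subtype.comp φ = MonoidHom.id F := b.ext_hom _ _ fun x => by simp [φ]
  rw [eq_top_iff]
  intro g _
  have hg : (φ g : F) = g := DFunLike.congr_fun h g
  exact hg ▸ (φ g).2

theorem ComputablePred.or {α : Type*} [Primcodable α] {p q : α → Prop} (hp : ComputablePred p)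
    (hq : ComputablePred q) : ComputablePred fun a => p a ∨ q a := by
  classical
  refine ⟨inferInstance, ?_⟩
  exact (Primrec.or.to_comp.comp hp.decide hq.decide).of_eq fun a => by simp

theorem ComputablePred.comp {α β : Type*} [Primcodable α] [Primcodable β] {p : β → Prop} {f : α → β}
    (hp : ComputablePred p) (hf : Computable f) : ComputablePred fun a => p (f a) := by
  classical
  exact ⟨inferInstance, (hp.decide.comp hf).of_eq fun _ => rfl⟩

namespace GroupWord

variable {X Y F F' : Type*} [Group F] [Group F']

theorem map_value (φ : F →* F') (b : X → F) (w : GroupWord X) :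
    φ (w.value b) = w.value fun x => φ (b x) := by
  simp only [value, map_list_prod, List.map_map]
  congr 2
  funext l
  simp only [Function.comp]
  split_ifs <;> simp

theorem value_congr {b b' : X → F} {w : GroupWord X} (h : ∀ l ∈ w, b l.1 = b' l.1) :
    w.value b = w.value b' := by
  unfold value
  congr 1
  exact List.map_congr_left fun l hl => by rw [h l hl]

theorem value_map (ν : X → Y) (b : Y → F) (w : GroupWord X) :
    value b (w.map fun l => (ν l.1, l.2)) = w.value fun x => b (ν x) := by
  simp [value, Function.comp_def]

theorem value_cons (b : X → F) (l : X × Bool) (w : GroupWord X) :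
    value b (l :: w) = (if l.2 then b l.1 else (b l.1)⁻¹) * w.value b := by
  simp [value]

end GroupWord

theorem lettersOf_finite {X : Type*} (W : List (GroupWord X)) : (lettersOf W).Finite := by
  refine (W.flatten.map Prod.fst).finite_toSet.subset ?_
  rintro x ⟨w, hw, e, he⟩
  exact List.mem_map.mpr ⟨(x, e), List.mem_flatten.mpr ⟨w, hw, he⟩, rfl⟩

theorem lettersOf_renameWords {X Y : Type*} (ν : X → Y) (W : List (GroupWord X)) :
    lettersOf (renameWords ν W) = ν '' lettersOf W := by
  ext y
  constructor
  · rintro ⟨w, hw, e, he⟩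
    obtain ⟨w, hw', rfl⟩ := List.mem_map.mp hw
    obtain ⟨l, hl, hle⟩ := List.mem_map.mp he
    exact ⟨l.1, ⟨w, hw', l.2, hl⟩, congrArg Prod.fst hle⟩
  · rintro ⟨x, ⟨w, hw, e, he⟩, rfl⟩
    exact ⟨_, List.mem_map.mpr ⟨w, hw, rfl⟩, e, List.mem_map.mpr ⟨_, he, rfl⟩⟩

/-- The letters can be interpreted by affine permutations modulo `p` such that all words fix `0`
and some letter that occurs does not. -/
def HasAffineSolution {X : Type*} (p : ℕ) (W : List (GroupWord X)) : Prop :=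
  ∃ f : X → AffineGroup (ZMod p), (∃ x ∈ lettersOf W, (f x).shift ≠ 0) ∧ ∀ w ∈ W, (w.value f).shift
      = 0

theorem hasAffineSolution_renameWords {X Y : Type*} {p : ℕ} {ν : X → Y} {W : List (GroupWord X)}
    (hν : Set.InjOn ν (lettersOf W)) : HasAffineSolution p (renameWords ν W) ↔ HasAffineSolution p
        W := by
  constructor
  · rintro ⟨f, ⟨y, hy, hfy⟩, hf⟩
    rw [lettersOf_renameWords] at hy
    obtain ⟨x, hx, rfl⟩ := hy
    refine ⟨fun x => f (ν x), ⟨x, hx, hfy⟩, fun w hw => ?_⟩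
    rw [← GroupWord.value_map]
    exact hf _ (List.mem_map.mpr ⟨w, hw, rfl⟩)
  · rintro ⟨f, ⟨x, hx, hfx⟩, hf⟩
    have : Nonempty X := ⟨x⟩
    have hinv : ∀ x ∈ lettersOf W, f (Function.invFunOn ν (lettersOf W) (ν x)) = f x := fun x hx => by
      rw [hν.leftInvOn_invFunOn hx]
    refine ⟨fun y => f (Function.invFunOn ν (lettersOf W) y), ⟨ν x, ?_, ?_⟩, ?_⟩
    · rw [lettersOf_renameWords]; exact ⟨x, hx, rfl⟩
    · beta_reduce
      rwa [hinv x hx]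
    · intro w' hw'
      obtain ⟨w, hw, rfl⟩ := List.mem_map.mp hw'
      rw [GroupWord.value_map, GroupWord.value_congr fun l hl => hinv l.1 ⟨w, hw, l.2, hl⟩]
      exact hf w hw

/-- The basis generates `F`, so an action that moves `0` has a basis letter that moves it; this
letter occurs in `W` if all do. -/
theorem not_isProDense_subgroupOfWords_iff {X F : Type*} [Group F] (b : FreeGroupBasis X F)
    (W : List (GroupWord X)) : ¬ IsProDense FiniteSupersolvable (subgroupOfWords b W) ↔
      lettersOf W ≠ Set.univ ∨ ∃ p : ℕ, p.Prime ∧ HasAffineSolution p W := by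
  rw [not_isProDense_iff_exists_affine_hom]
  have hfix : ∀ {p : ℕ} (φ : F →* AffineGroup (ZMod p)),
      (∀ g ∈ subgroupOfWords b W, (φ g).shift = 0) ↔
      ∀ w ∈ W, (w.value fun x => φ (b x)).shift = 0 := by
    intro p φ
    change subgroupOfWords b W ≤ (AffineGroup.stabilizerZero (ZMod p)).comap φ ↔ _
    rw [subgroupOfWords, Subgroup.closure_le]
    constructor
    · intro h w hw
      rw [← GroupWord.map_value]
      exact h ⟨w, hw, rfl⟩
    · rintro h _ ⟨w, hw, rfl⟩
      change (φ (w.value b)).shift = 0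
      rw [GroupWord.map_value]
      exact h w hw
  constructor
  · rintro ⟨p, hp, φ, hφ, g, hg⟩
    rw [or_iff_not_imp_left, not_not]
    intro huniv
    refine ⟨p, hp.out, fun x => φ (b x), ?_, (hfix φ).mp hφ⟩
    by_contra! h
    refine hg ?_
    have : (AffineGroup.stabilizerZero (ZMod p)).comap φ = ⊤ := by
      rw [eq_top_iff, ← b.closure_range, Subgroup.closure_le]
      rintro _ ⟨x, rfl⟩
      exact h x (huniv ▸ Set.mem_univ x)
    exact (this ▸ Subgroup.mem_top g : g ∈ (AffineGroup.stabilizerZero (ZMod p)).comap φ)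
  · rintro (h | ⟨p, hp, f, ⟨x, -, hx⟩, hf⟩)
    · obtain ⟨x, hx⟩ := (Set.ne_univ_iff_exists_notMem _).mp h
      classical
      -- An absent letter becomes the translation by `1` modulo `2` and all others the identity,
      -- which kills `H`.
      let f : X → AffineGroup (ZMod 2) := fun y => if y = x then ⟨1, 1⟩ else 1
      refine ⟨2, ⟨Nat.prime_two⟩, b.lift f, (hfix _).mpr fun w hw => ?_, b x, ?_⟩
      · have hb : (fun y => b.lift f (b y)) = f := by ext1 y; simp
        have h1 : w.value f = w.value fun _ => 1 := GroupWord.value_congr fun l hl =>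
          if_neg fun hl' => hx ⟨w, hw, l.2, by rw [← hl']; exact hl⟩
        have h2 : (w.value fun _ => (1 : AffineGroup (ZMod 2))) = 1 := by simp [GroupWord.value]
        rw [hb, h1, h2, AffineGroup.one_shift]
      · simp [f]
    · exact ⟨p, ⟨hp⟩, b.lift f, (hfix _).mpr (by simpa using hf), b x, by simpa using hx⟩

/-! ### The polynomial system of a list of words -/

/-- The letters that occur in a list of words, without repetitions. -/
def letterList (V : List (GroupWord ℕ)) : List ℕ := (V.flatten.map Prod.fst).dedup

theorem mem_letterList {V : List (GroupWord ℕ)} {x : ℕ} : x ∈ letterList V ↔ x ∈ lettersOf V := by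
  simp [letterList, lettersOf]

theorem nodup_letterList (V : List (GroupWord ℕ)) : (letterList V).Nodup := List.nodup_dedup _

theorem length_letterList (V : List (GroupWord ℕ)) : (letterList V).length = (lettersOf V).ncard := by
  rw [← List.toFinset_card_of_nodup (nodup_letterList V), ← Set.ncard_coe_finset]
  congr 1
  ext x
  simpa using mem_letterList

/-- The variable for the linear part of the affine permutation of a letter or of its inverse. -/
def scaleVar (l : ℕ × Bool) : ℕ := 5 * l.1 + if l.2 then 0 else 1

/-- The variable for the translation part of the affine permutation of a letter or of its inverse. -/
def shiftVar (l : ℕ × Bool) : ℕ := 5 * l.1 + if l.2 then 2 else 3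

/-- The image of `0` under the affine permutation of a word. -/
def wordPoly (w : GroupWord ℕ) : NatPoly :=
  w.foldr (fun l P => [shiftVar l] :: P.mulMonomial [scaleVar l]) []

/-- The equations that relate the variables of a letter and of its inverse. -/
def letterEquations (x : ℕ) : PolySystem :=
  [([[5 * x, 5 * x + 1]], [[]]), ([[5 * x + 1, 5 * x + 2], [5 * x + 3]], [])]

/-- The equation that expresses that some letter does not fix `0`. -/
def nonzeroEquation (L : List ℕ) : NatPoly × NatPoly :=
    (L.map fun x => [5 * x + 4, 5 * x + 2], [[]])

/-- The equations for affine permutations that make all the words fix `0`, but not all the letters. -/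
def affineSystem (V : List (GroupWord ℕ)) : PolySystem :=
  nonzeroEquation (letterList V) ::
    ((letterList V).flatMap letterEquations ++ V.map fun w => (wordPoly w, []))

/-- The recursion of `wordPoly` is the composition law `shift (l w) = scale l * shift w + shift l`;
separate variables for inverse letters keep it polynomial. -/
theorem eval_wordPoly {R : Type*} [CommRing R] {f : ℕ → AffineGroup R} {T : ℕ → R} {w : GroupWord ℕ}
    (h : ∀ l ∈ w, T (5 * l.1) = (f l.1).scale ∧ T (5 * l.1 + 1) = ((f l.1).scale⁻¹ : Rˣ) ∧
      T (5 * l.1 + 2) = (f l.1).shift ∧ T (5 * l.1 + 3) = (f l.1)⁻¹.shift) :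
    (wordPoly w).eval T = (w.value f).shift := by
  induction w with
  | nil => rfl
  | cons l w ih =>
    have ih := ih fun l' hl' => h l' (List.mem_cons_of_mem _ hl')
    obtain ⟨h0, h1, h2, h3⟩ := h l List.mem_cons_self
    rw [wordPoly, List.foldr_cons, ← wordPoly, GroupWord.value_cons, NatPoly.eval_cons,
        NatPoly.eval_mulMonomial, ih]
    obtain ⟨x, e⟩ := l
    cases e
    · simp_all [shiftVar, scaleVar]
      ring
    · simp_all [shiftVar, scaleVar]
      ring

theorem isSolution_affineSystem_iff {R : Type*} [CommRing R] {V : List (GroupWord ℕ)} {T : ℕ → R} :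
    (affineSystem V).IsSolution T ↔
      ((letterList V).map fun x => T (5 * x + 4) * T (5 * x + 2)).sum = 1 ∧
      (∀ x ∈ letterList V, T (5 * x) * T (5 * x + 1) = 1 ∧
        T (5 * x + 1) * T (5 * x + 2) + T (5 * x + 3) = 0) ∧
      ∀ w ∈ V, (wordPoly w).eval T = 0 := by
  simp only [PolySystem.IsSolution, affineSystem, List.forall_mem_cons, List.forall_mem_append,
    List.forall_mem_map, List.mem_flatMap, forall_exists_index, and_imp]
  refine and_congr ?_ (and_congr ?_ Iff.rfl)
  · simp [nonzeroEquation, NatPoly.eval, Function.comp_def]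
  · rw [forall_comm]
    refine forall_congr' fun x => ?_
    rw [forall_comm]
    refine forall_congr' fun _ => ?_
    simp [letterEquations]

/-- Over a field, some shift is nonzero exactly when a linear combination of the shifts equals `1`.
The variables `5 * x + 4` are its coefficients, and they turn the inequation into an equation. -/
theorem solvableModPrime_affineSystem_iff {V : List (GroupWord ℕ)} :
    (affineSystem V).SolvableModPrime ↔ ∃ p : ℕ, p.Prime ∧ HasAffineSolution p V := by
  classical
  refine exists_congr fun p => and_congr_right fun hp => ?_
  have : Fact p.Prime := ⟨hp⟩
  simp only [isSolution_affineSystem_iff]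
  constructor
  · rintro ⟨T, h1, h2, h3⟩
    let f : ℕ → AffineGroup (ZMod p) := fun x =>
      if hx : x ∈ letterList V then
        ⟨⟨T (5 * x), T (5 * x + 1), (h2 x hx).1, (mul_comm _ _).trans (h2 x hx).1⟩, T (5 * x + 2)⟩
            else 1
    have hf : ∀ x (hx : x ∈ letterList V), f x = ⟨⟨T (5 * x), T (5 * x + 1), (h2 x hx).1,
      (mul_comm _ _).trans (h2 x hx).1⟩, T (5 * x + 2)⟩ := fun x hx => dif_pos hx
    refine ⟨f, ?_, fun w hw => ?_⟩
    · by_contra! h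
      refine one_ne_zero (h1.symm.trans (List.sum_eq_zero ?_))
      simp only [List.mem_map]
      rintro _ ⟨x, hx, rfl⟩
      have := h x (mem_letterList.mp hx)
      rw [hf x hx] at this
      exact mul_eq_zero_of_right _ this
    · rw [← h3 w hw]
      refine (eval_wordPoly fun l hl => ?_).symm
      have hx := mem_letterList.mpr ⟨w, hw, l.2, hl⟩
      rw [hf _ hx]
      refine ⟨rfl, rfl, rfl, ?_⟩
      exact eq_neg_of_add_eq_zero_right (h2 _ hx).2
  · rintro ⟨f, ⟨x₀, hx₀, hne⟩, hf⟩
    let c : ℕ → ℕ → ZMod p := fun x => fun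
      | 0 => (f x).scale
      | 1 => ((f x).scale⁻¹ : (ZMod p)ˣ)
      | 2 => (f x).shift
      | 3 => (f x)⁻¹.shift
      -- Residue `4` holds the coefficient; only the letter `x₀` contributes, with the inverse of
      -- its shift.
      | _ => if x = x₀ then (f x).shift⁻¹ else 0
    let T : ℕ → ZMod p := fun i => c (i / 5) (i % 5)
    have hT : ∀ x k, k < 5 → T (5 * x + k) = c x k := fun x k hk => by
      simp only [T]
      rw [show (5 * x + k) / 5 = x by omega, show (5 * x + k) % 5 = k by omega]
    have h0 : ∀ x, T (5 * x) = (f x).scale := fun x => hT x 0 (by norm_num)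
    have h1 : ∀ x, T (5 * x + 1) = ((f x).scale⁻¹ : (ZMod p)ˣ) := fun x => hT x 1 (by norm_num)
    have h2 : ∀ x, T (5 * x + 2) = (f x).shift := fun x => hT x 2 (by norm_num)
    have h3 : ∀ x, T (5 * x + 3) = (f x)⁻¹.shift := fun x => hT x 3 (by norm_num)
    have h4 : ∀ x, T (5 * x + 4) = if x = x₀ then (f x).shift⁻¹ else 0 := fun x => hT x 4
        (by norm_num)
    refine ⟨T, ?_, fun x _ => ?_, fun w hw => ?_⟩
    · simp only [h2, h4]
      rw [← List.sum_toFinset _ (nodup_letterList V), Finset.sum_eq_single x₀]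
      · simp [hne]
      · intro x _ hx
        simp [hx]
      · intro h
        exact absurd (mem_letterList.mpr hx₀) fun h' => h (List.mem_toFinset.mpr h')
    · exact ⟨by rw [h0, h1, Units.mul_inv], by rw
          [h1, h2, h3, AffineGroup.inv_shift, add_neg_cancel]⟩
    · rw [eval_wordPoly fun l _ => ⟨h0 _, h1 _, h2 _, h3 _⟩, hf w hw]

theorem Primrec.list_dedup {α : Type*} [Primcodable α] [DecidableEq α] :
    Primrec (List.dedup : List α → List α) := by
  refine (Primrec.list_foldr (h := fun _ (q : α × List α) => if q.1 ∈ q.2 then q.2 else q.1 :: q.2)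
    Primrec.id (Primrec.const []) ?_).of_eq fun l => ?_
  · have h1 : Primrec fun a : List α × α × List α => a.2.1 := Primrec.fst.comp Primrec.snd
    have h2 : Primrec fun a : List α × α × List α => a.2.2 := Primrec.snd.comp Primrec.snd
    exact Primrec.ite (PolySystem.primrecRel_mem.comp h1 h2) h2 (Primrec.list_cons.comp h1 h2)
  · induction l with
    | nil => rfl
    | cons a l ih =>
      simp only [id, List.foldr_cons] at ih ⊢
      rw [ih]
      by_cases ha : a ∈ l
      · rw [List.dedup_cons_of_mem ha, if_pos (List.mem_dedup.mpr ha)]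
      · rw [List.dedup_cons_of_notMem ha, if_neg (mt List.mem_dedup.mp ha)]

theorem primrec_letterList : Primrec letterList :=
  Primrec.list_dedup.comp (Primrec.list_map Primrec.list_flatten (Primrec.fst.comp Primrec.snd).to₂)

theorem primrec_affineSystem : Primrec affineSystem := by
  have hv : ∀ k, Primrec fun x : ℕ => 5 * x + k := fun k =>
    Primrec.nat_add.comp (Primrec.nat_mul.comp (Primrec.const 5) Primrec.id) (Primrec.const k)
  have hl : ∀ j k, Primrec fun l : ℕ × Bool => 5 * l.1 + if l.2 then j else k := fun j k =>
    Primrec.nat_add.comp (Primrec.nat_mul.comp (Primrec.const 5) Primrec.fst)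
      (Primrec.ite (Primrec.eq.comp Primrec.snd (Primrec.const true)) (Primrec.const j)
          (Primrec.const k))
  have hone : ∀ {α : Type} [Primcodable α], Primrec fun a : α => [a] := fun {α} _ =>
    Primrec.list_cons.comp Primrec.id (Primrec.const [])
  have htwo : ∀ {α : Type} [Primcodable α] {f g : ℕ → α}, Primrec f → Primrec g →
      Primrec fun x => [f x, g x] := fun {α} _ {f g} hf hg => Primrec.list_cons.comp hf
          (hone.comp hg)
  have hword : Primrec wordPoly := by
    refine Primrec.list_foldr (h := fun _ (q : (ℕ × Bool) × NatPoly) =>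
      [shiftVar q.1] :: q.2.mulMonomial [scaleVar q.1]) Primrec.id (Primrec.const []) ?_
    exact Primrec.list_cons.comp (hone.comp ((hl 2 3).comp (Primrec.fst.comp Primrec.snd)))
      (NatPoly.primrec_mulMonomial.comp (hone.comp ((hl 0 1).comp (Primrec.fst.comp Primrec.snd)))
        (Primrec.snd.comp Primrec.snd))
  have hletter : Primrec letterEquations :=
    htwo ((hone.comp (htwo (hv 0) (hv 1))).pair (Primrec.const _))
      ((htwo (htwo (hv 1) (hv 2)) (hone.comp (hv 3))).pair (Primrec.const _))
  have hnz : Primrec nonzeroEquation :=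
    (Primrec.list_map Primrec.id ((htwo (hv 4) (hv 2)).comp Primrec.snd).to₂).pair (Primrec.const _)
  exact Primrec.list_cons.comp (hnz.comp primrec_letterList)
    (Primrec.list_append.comp
      (Primrec.list_flatMap primrec_letterList (hletter.comp Primrec.snd).to₂)
      (Primrec.list_map Primrec.id ((hword.comp Primrec.snd).pair (Primrec.const [])).to₂))

/-- Finitely many letters occur, so an infinite basis always has an absent one, and for a finite
basis counting decides. -/
theorem lettersOf_ne_univ_iff {X : Type*} (W : List (GroupWord X)) :
    lettersOf W ≠ Set.univ ↔
      rankDatum X = none ∨ (lettersOf W).ncard < (rankDatum X).getD 0 := by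
  by_cases hX : Finite X
  · simp only [rankDatum, if_pos hX, Option.getD_some, reduceCtorEq, false_or]
    rw [← Set.ncard_univ X]
    constructor
    · exact fun h => Set.ncard_lt_ncard (Set.ssubset_univ_iff.mpr h)
    · rintro h heq
      rw [heq] at h
      exact h.false
  · simp only [rankDatum, if_neg hX, true_or, iff_true]
    intro h
    exact hX (Set.finite_univ_iff.mp (h ▸ lettersOf_finite W))

/-- There is one decision procedure `D` for all free groups `F` (with a basis `b` indexed by a set
`X` of any cardinality) and all finitely generated subgroups `H`. Its input is the rank of `F`
together with a finite list of words generating `H`, in which the finitely many letters that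
occur are named by distinct natural numbers. -/
theorem theorem1p1 :
    ∃ D : Option ℕ × List (GroupWord ℕ) → Prop, ComputablePred D ∧
      ∀ (X : Type*) (F : Type*) [Group F] (b : FreeGroupBasis X F)
        (H : Subgroup F) (W : List (GroupWord X)), H = subgroupOfWords b W →
        ∀ ν : X → ℕ, Set.InjOn ν (lettersOf W) →
          (D (rankDatum X, renameWords ν W) ↔ IsProDense FiniteSupersolvable H) := by
  -- The default `0` is harmless: for infinite rank the first alternative already holds.
  refine ⟨fun q => ¬ ((q.1 = none ∨ (letterList q.2).length < q.1.getD 0) ∨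
    (affineSystem q.2).SolvableModPrime), ?_, ?_⟩
  · refine (ComputablePred.or ?_ ?_).not
    · refine PrimrecPred.computablePred (PrimrecPred.or ?_ ?_)
      · exact Primrec.eq.comp Primrec.fst (Primrec.const none)
      · exact Primrec.nat_lt.comp (Primrec.list_length.comp (primrec_letterList.comp Primrec.snd))
          (Primrec.option_getD.comp Primrec.fst (Primrec.const 0))
    · exact PolySystem.computablePred_solvableModPrime.comp
          (primrec_affineSystem.comp Primrec.snd).to_comp
  · rintro X F _ b H W rfl ν hν
    rw [not_iff_comm, not_isProDense_subgroupOfWords_iff, lettersOf_ne_univ_iff,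
      solvableModPrime_affineSystem_iff, length_letterList, lettersOf_renameWords,
      hν.ncard_image]
    simp only [hasAffineSolution_renameWords hν]
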